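/- Let $(\Omega,\Sigma,\mu)$ be a $\sigma$-finite measure space; all function spaces below consist of ($\mu$-a.e. equivalence classes of) real-valued, or of complex-valued, measurable functions on $\Omega$. For Banach function spaces $X_0,X_1$ on $\Omega$ let $\mathcal A(X_0,X_1)$ be the set of all maps $T:X_0+X_1\to X_0+X_1$ such that $|T(x+y)|\le |Tx|+|Ty|$ a.e. for all $x,y\in X_0+X_1$ (subadditivity), $T(X_i)\subset X_i$ and $M_i:=\sup_{0\ne x\in X_i}\|Tx\|_{X_i}/\|x\|_{X_i}<\infty$ for $i=0,1$; put $M:=\max\{M_0,M_1\}$. A Banach space $X$ is an interpolation space for subadditive operators between $X_0$ and $X_1$ with constant $C$ if $X_0\cap X_1\subset X\subset X_0+X_1$ with continuous embeddings and every $T\in\mathcal A(X_0,X_1)$ maps $X$ into itself with $\|T\|_{X\to X}:=\sup_{0\ne x\in X}\|Tx\|_X/\|x\|_X\le CM$. An Orlicz function is a nondecreasing convex function $\varphi:[0,\infty)\to[0,\infty]$ with $\varphi(0)=0$ and $\lim_{u\to0+}\varphi(u)=0$ that is neither identically $0$ nor identically $\infty$ on $(0,\infty)$. Put $I_\varphi(x):=\int_\Omega\varphi(|x|)\,d\mu$;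 the Orlicz space $L^\varphi$ consists of all $x$ with $I_\varphi(\lambda x)<\infty$ for some $\lambda>0$; its Luxemburg–Nakano norm is $\inf\{\lambda>0: I_\varphi(x/\lambda)\le1\}$ and its Orlicz norm is $\inf_{k>0}\frac1k\bigl(1+I_\varphi(kx)\bigr)$. Let $1\le p<\infty$. (a) Let $\varphi$ be a left-continuous Orlicz function such that $u\mapsto\varphi(u^{1/p})$ is convex, and let $T\in\mathcal A(L^p,L^\infty)$. Then $$I_\varphi\left(\frac{Tx}{2^{1-1/p}M}\right)\le I_\varphi(x)\qquad\text{for all }x\in L^p+L^\infty,$$ where the quotient is read as $0$ if $M=0$ (in which case $Tx=0$ a.e.). (b) Let $\rho:[0,\infty)\to[0,\infty)$ be concave, continuous and positive on $(0,\infty)$, with $\rho(s)\le\max(1,s/t)\,\rho(t)$ for all $s,t>0$, and suppose that $\rho_*(t):=t\rho(1/t)$ maps $(0,\infty)$ onto $(0,\infty)$. Let $\varphi$ be the function with $\varphi(0)=0$ and $\varphi^{-1}(u)=u^{1/p}\rho(u^{-1/p})$ for all $u>0$. Then $\varphi$ is an Orlicz function, and $L^\varphi$, both with the Luxemburg–Nakano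 norm and with the Orlicz norm, is an interpolation space for subadditive operators between $L^p$ and $L^\infty$ with constant $2^{1-1/p}$; that is, $\|T\|_{L^\varphi\to L^\varphi}\le 2^{1-1/p}\max\{\|T\|_{L^p\to L^p},\|T\|_{L^\infty\to L^\infty}\}$ for every $T\in\mathcal A(L^p,L^\infty)$. In particular, for $p=1$ the constant is $1$. -/

import Mathlib

open MeasureTheory Set Filter Topology
open scoped NNReal ENNReal Pointwise

/-- `φ : [0,∞) → [0,∞]` is an Orlicz function: nondecreasing, convex, `φ(0) = 0`,
`φ(u) → 0` as `u → 0+`, and neither identically zero nor identically infinite on `(0,∞)`. -/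
structure IsOrliczFunction (φ : ℝ≥0 → ℝ≥0∞) : Prop where
  mono : Monotone φ
  convex : ConvexOn ℝ≥0 univ φ
  map_zero : φ 0 = 0
  tendsto_zero : Tendsto φ (𝓝[>] 0) (𝓝 0)
  not_zero : ∃ u, 0 < u ∧ φ u ≠ 0
  not_top : ∃ u, 0 < u ∧ φ u ≠ ⊤

/-- Left continuity of `φ : [0,∞) → [0,∞]` at every point. -/
def IsLeftContinuous (φ : ℝ≥0 → ℝ≥0∞) : Prop :=
  ∀ u, ContinuousWithinAt φ (Iio u) u

/-- `ρ : [0,∞) → [0,∞)` is quasi-concave. -/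
structure IsQuasiConcave (ρ : ℝ≥0 → ℝ≥0) : Prop where
  continuousOn : ContinuousOn ρ (Ioi 0)
  pos : ∀ t, 0 < t → 0 < ρ t
  le_max_mul : ∀ s t, 0 < s → 0 < t → ρ s ≤ max 1 (s / t) * ρ t

/-- `ρ` is quasi-concave and concave. -/
def IsConcaveQuasiConcave (ρ : ℝ≥0 → ℝ≥0) : Prop :=
  IsQuasiConcave ρ ∧ ConcaveOn ℝ≥0 univ ρ

/-- `ρ_*(t) = t ρ(1/t)`. -/
noncomputable def rhoStar (ρ : ℝ≥0 → ℝ≥0) (t : ℝ≥0) : ℝ≥0 :=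
  t * ρ (1 / t)

/-- A set of (classes of a.e. equal) functions on `Ω`, together with a functional which plays
the role of the norm on that set; the values of the functional off the set are never used. -/
structure FnSpace {Ω : Type*} [MeasurableSpace Ω] (𝕜 : Type*) [RCLike 𝕜] (μ : Measure Ω) where
  carrier : Set (Ω →ₘ[μ] 𝕜)
  nrm : (Ω →ₘ[μ] 𝕜) → ℝ≥0∞

section

variable {Ω : Type*} [MeasurableSpace Ω] {𝕜 : Type*} [RCLike 𝕜] {μ : Measure Ω}

/-- The modular `I_φ(x) = ∫ φ(|x(t)|) dμ(t)`. -/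
noncomputable def modular (φ : ℝ≥0 → ℝ≥0∞) (x : Ω →ₘ[μ] 𝕜) : ℝ≥0∞ :=
  ∫⁻ t, φ ‖x t‖₊ ∂μ

/-- The set underlying the Orlicz space `L^φ`. -/
def orliczCarrier (φ : ℝ≥0 → ℝ≥0∞) : Set (Ω →ₘ[μ] 𝕜) :=
  {x | ∃ l : ℝ, 0 < l ∧ modular φ (l • x) < ⊤}

/-- The Luxemburg–Nakano norm. -/
noncomputable def luxemburgNorm (φ : ℝ≥0 → ℝ≥0∞) (x : Ω →ₘ[μ] 𝕜) : ℝ≥0∞ :=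
  ⨅ (l : ℝ) (_ : 0 < l) (_ : modular φ (l⁻¹ • x) ≤ 1), ENNReal.ofReal l

/-- The Orlicz norm in the Amemiya form. -/
noncomputable def orliczNorm (φ : ℝ≥0 → ℝ≥0∞) (x : Ω →ₘ[μ] 𝕜) : ℝ≥0∞ :=
  ⨅ (k : ℝ) (_ : 0 < k), (ENNReal.ofReal k)⁻¹ * (1 + modular φ (k • x))

namespace FnSpace

/-- The Lebesgue space `L^p`. -/
noncomputable def lebesgue (𝕜 : Type*) [RCLike 𝕜] (μ : Measure Ω) (p : ℝ≥0∞) : FnSpace 𝕜 μ where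
  carrier := {x | x ∈ Lp 𝕜 p μ}
  nrm x := eLpNorm x p μ

/-- The Orlicz space `L^φ` with the Luxemburg–Nakano norm. -/
noncomputable def orliczLuxemburg (𝕜 : Type*) [RCLike 𝕜] (μ : Measure Ω) (φ : ℝ≥0 → ℝ≥0∞) :
    FnSpace 𝕜 μ where
  carrier := orliczCarrier φ
  nrm := luxemburgNorm φ

/-- The Orlicz space `L^φ` with the Orlicz norm. -/
noncomputable def orliczAmemiya (𝕜 : Type*) [RCLike 𝕜] (μ : Measure Ω) (φ : ℝ≥0 → ℝ≥0∞) :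
    FnSpace 𝕜 μ where
  carrier := orliczCarrier φ
  nrm := orliczNorm φ

/-- `X` is a Banach space: a linear subspace of the space of classes of measurable functions
on which `nrm` is a (finite) complete norm. -/
structure IsBanach (X : FnSpace 𝕜 μ) : Prop where
  zero_mem : 0 ∈ X.carrier
  add_mem : ∀ x ∈ X.carrier, ∀ y ∈ X.carrier, x + y ∈ X.carrier
  smul_mem : ∀ (c : 𝕜), ∀ x ∈ X.carrier, c • x ∈ X.carrier
  nrm_lt_top : ∀ x ∈ X.carrier, X.nrm x < ⊤
  nrm_eq_zero_iff : ∀ x ∈ X.carrier, X.nrm x = 0 ↔ x = 0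
  nrm_add_le : ∀ x ∈ X.carrier, ∀ y ∈ X.carrier, X.nrm (x + y) ≤ X.nrm x + X.nrm y
  nrm_smul : ∀ (c : 𝕜), ∀ x ∈ X.carrier, X.nrm (c • x) = ‖c‖ₑ * X.nrm x
  complete : ∀ u : ℕ → (Ω →ₘ[μ] 𝕜), (∀ n, u n ∈ X.carrier) →
    (∀ ε : ℝ≥0∞, 0 < ε → ∃ n₀, ∀ m ≥ n₀, ∀ n ≥ n₀, X.nrm (u m - u n) < ε) →
    ∃ x ∈ X.carrier, Tendsto (fun n => X.nrm (u n - x)) atTop (𝓝 0)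

/-- The set underlying the sum `X₀ + X₁`. -/
def sum (X₀ X₁ : FnSpace 𝕜 μ) : Set (Ω →ₘ[μ] 𝕜) := X₀.carrier + X₁.carrier

/-- The norm of the intersection `X₀ ∩ X₁`. -/
noncomputable def interNrm (X₀ X₁ : FnSpace 𝕜 μ) (x : Ω →ₘ[μ] 𝕜) : ℝ≥0∞ :=
  max (X₀.nrm x) (X₁.nrm x)

/-- The norm of the sum `X₀ + X₁`. -/
noncomputable def sumNrm (X₀ X₁ : FnSpace 𝕜 μ) (x : Ω →ₘ[μ] 𝕜) : ℝ≥0∞ :=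
  ⨅ (x₀ ∈ X₀.carrier) (x₁ ∈ X₁.carrier) (_ : x = x₀ + x₁), X₀.nrm x₀ + X₁.nrm x₁

/-- `T : X₀ + X₁ → X₀ + X₁` is subadditive. -/
def IsSubadditive {X₀ X₁ : FnSpace 𝕜 μ} (T : sum X₀ X₁ → sum X₀ X₁) : Prop :=
  ∀ x y z : sum X₀ X₁, z.1 = x.1 + y.1 →
    ∀ᵐ t ∂μ, ‖(T z).1 t‖ ≤ ‖(T x).1 t‖ + ‖(T y).1 t‖

/-- The operator norm `‖T‖_{X → X} = sup { ‖Tx‖_X / ‖x‖_X : x ∈ X, x ≠ 0 }` of the restriction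
to `X` of an operator on `X₀ + X₁`. -/
noncomputable def opNrm {X₀ X₁ : FnSpace 𝕜 μ} (T : sum X₀ X₁ → sum X₀ X₁) (X : FnSpace 𝕜 μ) :
    ℝ≥0∞ :=
  ⨆ (x : sum X₀ X₁) (_ : x.1 ∈ X.carrier) (_ : x.1 ≠ 0), X.nrm (T x).1 / X.nrm x.1

/-- `T` maps `X` into itself. -/
def MapsInto {X₀ X₁ : FnSpace 𝕜 μ} (T : sum X₀ X₁ → sum X₀ X₁) (X : FnSpace 𝕜 μ) : Prop :=
  ∀ x : sum X₀ X₁, x.1 ∈ X.carrier → (T x).1 ∈ X.carrier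

/-- The class of admissible operators: subadditive operators on `X₀ + X₁` whose restrictions
to `X₀` and `X₁` are bounded operators of these spaces into themselves. -/
structure IsAdmissible {X₀ X₁ : FnSpace 𝕜 μ} (T : sum X₀ X₁ → sum X₀ X₁) : Prop where
  subadditive : IsSubadditive T
  mapsInto₀ : MapsInto T X₀
  mapsInto₁ : MapsInto T X₁
  bounded₀ : opNrm T X₀ < ⊤
  bounded₁ : opNrm T X₁ < ⊤

/-- `M = max (‖T‖_{X₀ → X₀}, ‖T‖_{X₁ → X₁})`. -/
noncomputable def maxNrm {X₀ X₁ : FnSpace 𝕜 μ} (T : sum X₀ X₁ → sum X₀ X₁) : ℝ≥0∞ :=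
  max (opNrm T X₀) (opNrm T X₁)

/-- The Banach space `X` is an interpolation space for subadditive operators between `X₀` and
`X₁`, with interpolation constant `C`. -/
structure IsInterpolationSpace (X₀ X₁ X : FnSpace 𝕜 μ) (C : ℝ≥0∞) : Prop where
  banach : X.IsBanach
  inter_subset : X₀.carrier ∩ X₁.carrier ⊆ X.carrier
  inter_continuous : ∃ c : ℝ≥0, ∀ x ∈ X₀.carrier ∩ X₁.carrier, X.nrm x ≤ c * interNrm X₀ X₁ x
  subset_sum : X.carrier ⊆ sum X₀ X₁
  sum_continuous : ∃ c : ℝ≥0, ∀ x ∈ X.carrier, sumNrm X₀ X₁ x ≤ c * X.nrm x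
  mapsInto : ∀ T : sum X₀ X₁ → sum X₀ X₁, IsAdmissible T → MapsInto T X
  opNrm_le : ∀ T : sum X₀ X₁ → sum X₀ X₁, IsAdmissible T → opNrm T X ≤ C * maxNrm T

end FnSpace

end

/-!
Let `x ∈ L^p + L^∞` and split `x` at the level `l` into its radial truncation, which is bounded by
`l`, and the remainder, whose `p`-th power is at most `|x|^p - l^p`. Subadditivity together with
`(a + b)^p ≤ 2^(p-1) (a^p + b^p)` turns the two endpoint bounds into
`∫ (|Tx|^p / (2^(p-1) M^p) - s)₊ ≤ ∫ (|x|^p - s)₊` for every `s = l^p`. The left-continuous convex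
function `u ↦ φ(u^(1/p))` is the integral of its nondecreasing right derivative, and by the layer
cake formula the hinge inequalities therefore pass to it: this is (a).

For (b), write `h = ρ_*`. Then `φ(h(s)) = s^p`, so that `u ↦ φ(u^(1/p))` is the inverse of
`u ↦ h(u^(1/p))^p`. The latter is concave: it suffices to treat affine `h` with nonnegative
coefficients, because `h` lies below such a function that agrees with it at a given point, and for
affine `h` the claim is Minkowski's inequality in `ℓ^p`. The Luxemburg and the Orlicz norm are both
of the form `inf_l l W(I_φ(x / l))`, so any modular inequality carries over to them.
-/

/-! ### Convex functions as integrals of their right derivative -/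

theorem intervalIntegrable_rightDeriv_of_convexOn {P : ℝ → ℝ} {S : Set ℝ} {a b : ℝ}
    (hP : ConvexOn ℝ S P) (hab : a ≤ b) (hS : Icc a b ⊆ interior S) :
    IntervalIntegrable (fun t => derivWithin P (Ioi t) t) volume a b :=
  MonotoneOn.intervalIntegrable <| by
    simpa only [uIcc_of_le hab] using hP.monotoneOn_rightDeriv.mono hS

theorem integral_rightDeriv_of_convexOn {P : ℝ → ℝ} {S : Set ℝ} {a b : ℝ}
    (hP : ConvexOn ℝ S P) (hab : a ≤ b) (hS : Icc a b ⊆ interior S) :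
    ∫ t in a..b, derivWithin P (Ioi t) t = P b - P a :=
  intervalIntegral.integral_eq_sub_of_hasDeriv_right_of_le hab (hP.continuousOn_interior.mono hS)
    (fun _ ht => hP.hasDerivWithinAt_rightDeriv_of_mem_interior (hS (Ioo_subset_Icc_self ht)))
    (intervalIntegrable_rightDeriv_of_convexOn hP hab hS)

theorem rightDeriv_nonneg_of_monotoneOn {P : ℝ → ℝ} {v t : ℝ} (hP : MonotoneOn P (Iic v))
    (ht : t < v) : 0 ≤ derivWithin P (Ioi t) t := by
  rw [← derivWithin_inter (Iio_mem_nhds ht)]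
  exact (hP.mono fun _ hs => (mem_Iio.1 hs.2).le).derivWithin_nonneg

section ExtendedRightDeriv

variable {ψ : ℝ≥0 → ℝ≥0∞} {u v : ℝ≥0}

theorem map_toNNReal_ne_top_of_le (hm : Monotone ψ) (hv : ψ v ≠ ⊤) {t : ℝ} (ht : t ≤ v) :
    ψ t.toNNReal ≠ ⊤ :=
  ne_top_of_le_ne_top hv (hm (Real.toNNReal_le_iff_le_coe.2 ht))

theorem monotoneOn_toReal_Iic (hm : Monotone ψ) (hv : ψ v ≠ ⊤) :
    MonotoneOn (fun t : ℝ => (ψ t.toNNReal).toReal) (Iic v) := fun _ _ _ ht hst =>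
  ENNReal.toReal_mono (map_toNNReal_ne_top_of_le hm hv ht) (hm (Real.toNNReal_le_toNNReal hst))

theorem convexOn_toReal_Iic (hm : Monotone ψ) (hc : ConvexOn ℝ≥0 univ ψ) (hv : ψ v ≠ ⊤) :
    ConvexOn ℝ (Iic (v : ℝ)) (fun t : ℝ => (ψ t.toNNReal).toReal) := by
  refine ⟨convex_Iic _, fun x hx y hy a b ha hb hab => ?_⟩
  lift a to ℝ≥0 using ha
  lift b to ℝ≥0 using hb
  have hx_top : a • ψ x.toNNReal ≠ ⊤ :=
    ENNReal.mul_ne_top ENNReal.coe_ne_top (map_toNNReal_ne_top_of_le hm hv hx)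
  have hy_top : b • ψ y.toNNReal ≠ ⊤ :=
    ENNReal.mul_ne_top ENNReal.coe_ne_top (map_toNNReal_ne_top_of_le hm hv hy)
  have hcomb : ((a : ℝ) • x + (b : ℝ) • y).toNNReal ≤ a • x.toNNReal + b • y.toNNReal := by
    refine Real.toNNReal_le_iff_le_coe.2 ?_
    simp only [smul_eq_mul, NNReal.coe_add, NNReal.coe_mul]
    gcongr <;> exact Real.le_coe_toNNReal _
  have hle : ψ ((a : ℝ) • x + (b : ℝ) • y).toNNReal ≤ a • ψ x.toNNReal + b • ψ y.toNNReal :=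
    (hm hcomb).trans (hc.2 (mem_univ _) (mem_univ _) zero_le zero_le (by exact_mod_cast hab))
  refine (ENNReal.toReal_mono (ENNReal.add_ne_top.2 ⟨hx_top, hy_top⟩) hle).trans_eq ?_
  rw [ENNReal.toReal_add hx_top hy_top]
  simp [ENNReal.smul_def, ENNReal.toReal_mul]

open Classical in
/-- The right derivative of a nondecreasing convex function with values in `[0,∞]`; it is `∞` at
those points to the right of which the function is infinite. -/
noncomputable def extendedRightDeriv (ψ : ℝ≥0 → ℝ≥0∞) (t : ℝ) : ℝ≥0∞ :=
  if ∃ v : ℝ≥0, t < v ∧ ψ v ≠ ⊤ then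
    ENNReal.ofReal (derivWithin (fun t : ℝ => (ψ t.toNNReal).toReal) (Ioi t) t) else ⊤

theorem extendedRightDeriv_of_lt (hv : ψ v ≠ ⊤) {t : ℝ} (ht : t < v) :
    extendedRightDeriv ψ t =
      ENNReal.ofReal (derivWithin (fun t : ℝ => (ψ t.toNNReal).toReal) (Ioi t) t) :=
  if_pos ⟨v, ht, hv⟩

theorem extendedRightDeriv_eq_top_of_le (hm : Monotone ψ) (hv : ψ v = ⊤) {t : ℝ} (ht : v ≤ t) :
    extendedRightDeriv ψ t = ⊤ := by
  refine if_neg fun ⟨w, htw, hw⟩ => hw ?_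
  exact top_le_iff.1 (hv ▸ hm (NNReal.coe_le_coe.1 (ht.trans htw.le)))

theorem monotone_extendedRightDeriv (hm : Monotone ψ) (hc : ConvexOn ℝ≥0 univ ψ) :
    Monotone (extendedRightDeriv ψ) := by
  intro s t hst
  by_cases ht : ∃ v : ℝ≥0, t < v ∧ ψ v ≠ ⊤
  · obtain ⟨v, htv, hv⟩ := ht
    have hsv : s < v := hst.trans_lt htv
    rw [extendedRightDeriv_of_lt hv htv, extendedRightDeriv_of_lt hv hsv]
    refine ENNReal.ofReal_le_ofReal
      ((convexOn_toReal_Iic hm hc hv).monotoneOn_rightDeriv ?_ ?_ hst) <;>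
      simpa only [interior_Iic, mem_Iio]
  · exact le_top.trans_eq (if_neg ht).symm

theorem eq_lintegral_extendedRightDeriv_of_lt (hm : Monotone ψ) (hc : ConvexOn ℝ≥0 univ ψ)
    (h0 : ψ 0 = 0) (huv : u < v) (hv : ψ v ≠ ⊤) :
    ψ u = ∫⁻ t in Ioo 0 (u : ℝ), extendedRightDeriv ψ t := by
  set P : ℝ → ℝ := fun t => (ψ t.toNNReal).toReal with hP
  have hconv : ConvexOn ℝ (Iic (v : ℝ)) P := convexOn_toReal_Iic hm hc hv
  have huv' : (u : ℝ) < v := NNReal.coe_lt_coe.2 huv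
  have hsub : Icc 0 (u : ℝ) ⊆ interior (Iic (v : ℝ)) := by
    rw [interior_Iic]; exact fun t ht => ht.2.trans_lt huv'
  have hnonneg : ∀ t ∈ Ioo 0 (u : ℝ), 0 ≤ derivWithin P (Ioi t) t := fun t ht =>
    rightDeriv_nonneg_of_monotoneOn (monotoneOn_toReal_Iic hm hv) (ht.2.trans huv')
  calc ψ u = ENNReal.ofReal (P u - P 0) := by
        simp [hP, h0, ENNReal.ofReal_toReal (ne_top_of_le_ne_top hv (hm huv.le))]
    _ = ENNReal.ofReal (∫ t in Ioo 0 (u : ℝ), derivWithin P (Ioi t) t) := by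
        rw [← integral_rightDeriv_of_convexOn hconv u.coe_nonneg hsub,
          intervalIntegral.integral_of_le u.coe_nonneg, integral_Ioc_eq_integral_Ioo]
    _ = ∫⁻ t in Ioo 0 (u : ℝ), ENNReal.ofReal (derivWithin P (Ioi t) t) :=
        ofReal_integral_eq_lintegral_ofReal
          ((intervalIntegrable_iff_integrableOn_Ioo_of_le u.coe_nonneg).1
            (intervalIntegrable_rightDeriv_of_convexOn hconv u.coe_nonneg hsub))
          ((ae_restrict_mem measurableSet_Ioo).mono hnonneg)
    _ = ∫⁻ t in Ioo 0 (u : ℝ), extendedRightDeriv ψ t :=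
        setLIntegral_congr_fun measurableSet_Ioo fun t ht =>
          (extendedRightDeriv_of_lt hv (ht.2.trans huv')).symm

theorem lintegral_extendedRightDeriv_eq_top (hm : Monotone ψ) (huv : u < v) (hu : ψ u = ⊤) :
    ∫⁻ t in Ioo 0 (v : ℝ), extendedRightDeriv ψ t = ⊤ := by
  refine top_le_iff.1 ?_
  calc (⊤ : ℝ≥0∞) = ∫⁻ _ in Ioo (u : ℝ) v, ⊤ := by
        rw [setLIntegral_const, Real.volume_Ioo, ENNReal.top_mul (by simpa using huv)]
    _ = ∫⁻ t in Ioo (u : ℝ) v, extendedRightDeriv ψ t :=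
        setLIntegral_congr_fun measurableSet_Ioo fun t ht =>
          (extendedRightDeriv_eq_top_of_le hm hu ht.1.le).symm
    _ ≤ ∫⁻ t in Ioo 0 (v : ℝ), extendedRightDeriv ψ t :=
        lintegral_mono_set (Ioo_subset_Ioo_left u.coe_nonneg)

theorem iUnion_Ioo_zero_eq_of_tendsto {w : ℕ → ℝ≥0} (hlt : ∀ n, w n < u)
    (hw : Tendsto w atTop (𝓝 u)) : ⋃ n, Ioo 0 (w n : ℝ) = Ioo 0 (u : ℝ) := by
  ext t
  simp only [mem_iUnion, mem_Ioo, exists_and_left, and_congr_right_iff]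
  refine fun _ => ⟨fun ⟨n, hn⟩ => hn.trans (NNReal.coe_lt_coe.2 (hlt n)), fun htu => ?_⟩
  exact ((NNReal.tendsto_coe.2 hw).eventually (lt_mem_nhds htu)).exists

theorem eq_lintegral_extendedRightDeriv (hm : Monotone ψ) (hc : ConvexOn ℝ≥0 univ ψ)
    (h0 : ψ 0 = 0) (hl : IsLeftContinuous ψ) (u : ℝ≥0) :
    ψ u = ∫⁻ t in Ioo 0 (u : ℝ), extendedRightDeriv ψ t := by
  rcases eq_or_ne u 0 with rfl | hu0
  · simp [h0]
  by_cases hfin : ∀ w < u, ψ w ≠ ⊤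
  · obtain ⟨w, hw, hwu, hwt⟩ := exists_seq_strictMono_tendsto' (pos_iff_ne_zero.2 hu0)
    have hlim : Tendsto (fun n => ψ (w n)) atTop (𝓝 (ψ u)) :=
      (hl u).tendsto.comp (tendsto_nhdsWithin_iff.2 ⟨hwt, .of_forall fun n => (hwu n).2⟩)
    have hdir : Monotone fun n => Ioo 0 (w n : ℝ) := fun m n hmn =>
      Ioo_subset_Ioo_right (NNReal.coe_le_coe.2 (hw.monotone hmn))
    rw [← iUnion_Ioo_zero_eq_of_tendsto (fun n => (hwu n).2) hwt,
      setLIntegral_iUnion_of_directed _ hdir.directed_le,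
      tendsto_nhds_unique hlim (tendsto_atTop_iSup (hm.comp hw.monotone))]
    exact iSup_congr fun n => eq_lintegral_extendedRightDeriv_of_lt hm hc h0
      (hw n.lt_succ_self) (hfin _ (hwu _).2)
  · push Not at hfin
    obtain ⟨w, hwu, hw⟩ := hfin
    rw [lintegral_extendedRightDeriv_eq_top hm hwu hw, ← top_le_iff, ← hw]
    exact hm hwu.le

end ExtendedRightDeriv

/-! ### Hinge domination -/

theorem setLIntegral_inter_Ioi_le_of_isUpperSet {F G : ℝ → ℝ≥0∞}
    (h : ∀ s : ℝ≥0, ∫⁻ t in Ioi (s : ℝ), F t ≤ ∫⁻ t in Ioi (s : ℝ), G t) {U : Set ℝ}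
    (hU : IsUpperSet U) : ∫⁻ t in U ∩ Ioi 0, F t ≤ ∫⁻ t in U ∩ Ioi 0, G t := by
  rcases (U ∩ Ioi 0).eq_empty_or_nonempty with hempty | hne
  · simp [hempty]
  have hbdd : BddBelow (U ∩ Ioi 0) := ⟨0, fun _ ht => ht.2.le⟩
  set s := sInf (U ∩ Ioi 0)
  have hs0 : 0 ≤ s := le_csInf hne fun _ ht => ht.2.le
  have hsub : Ioi s ⊆ U ∩ Ioi 0 := fun t ht => by
    obtain ⟨r, hr, hrt⟩ := exists_lt_of_csInf_lt hne ht
    exact ⟨hU hrt.le hr.1, hs0.trans_lt ht⟩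
  have hsup : U ∩ Ioi 0 ⊆ Ici s := fun t ht => csInf_le hbdd ht
  have hae : (U ∩ Ioi 0 : Set ℝ) =ᵐ[volume] Ioi s :=
    (hsup.eventuallyLE.trans_eq Ioi_ae_eq_Ici.symm).antisymm hsub.eventuallyLE
  rw [setLIntegral_congr hae, setLIntegral_congr hae]
  exact h ⟨s, hs0⟩

theorem setLIntegral_mul_le_of_monotone {F G : ℝ → ℝ≥0∞} (hF : Measurable F) (hG : Measurable G)
    (h : ∀ s : ℝ≥0, ∫⁻ t in Ioi (s : ℝ), F t ≤ ∫⁻ t in Ioi (s : ℝ), G t) {κ : ℝ → ℝ≥0}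
    (hκ : Monotone κ) : ∫⁻ t in Ioi 0, F t * κ t ≤ ∫⁻ t in Ioi 0, G t * κ t := by
  have layer : ∀ {H : ℝ → ℝ≥0∞}, Measurable H →
      ∫⁻ t in Ioi 0, H t * κ t = ∫⁻ r in Ioi (0 : ℝ), ∫⁻ t in {t | r < κ t} ∩ Ioi 0, H t := by
    intro H hH
    have hcake := lintegral_eq_lintegral_meas_lt ((volume.restrict (Ioi 0)).withDensity H)
      (.of_forall fun t => (κ t).coe_nonneg) hκ.measurable.coe_nnreal_real.aemeasurable
    rw [lintegral_withDensity_eq_lintegral_mul _ hH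
      hκ.measurable.coe_nnreal_real.ennreal_ofReal] at hcake
    simp only [Pi.mul_apply, ENNReal.ofReal_coe_nnreal] at hcake
    rw [hcake]
    refine lintegral_congr fun r => ?_
    have hmeas : MeasurableSet {t | r < κ t} :=
      measurableSet_lt measurable_const hκ.measurable.coe_nnreal_real
    rw [withDensity_apply _ hmeas, Measure.restrict_restrict hmeas]
  rw [layer hF, layer hG]
  exact lintegral_mono fun r => setLIntegral_inter_Ioi_le_of_isUpperSet h
    fun _ _ hab ha => ha.trans_le (NNReal.coe_le_coe.2 (hκ hab))

section HingeDomination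

variable {Ω : Type*} [MeasurableSpace Ω] {μ : Measure Ω} {f g : Ω → ℝ≥0}

theorem lintegral_setLIntegral_Ioo_eq (hf : Measurable f) {κ : ℝ → ℝ≥0} (hκ : Monotone κ) :
    ∫⁻ ω, (∫⁻ t in Ioo 0 (f ω : ℝ), κ t) ∂μ = ∫⁻ t in Ioi (0 : ℝ), μ {ω | t < f ω} * κ t := by
  have hint : ∀ a b : ℝ, IntervalIntegrable (fun t => (κ t : ℝ)) volume a b := fun _ _ =>
    Monotone.intervalIntegrable fun _ _ hab => NNReal.coe_le_coe.2 (hκ hab)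
  have hcake := lintegral_comp_eq_lintegral_meas_lt_mul μ (.of_forall fun ω => (f ω).coe_nonneg)
    hf.coe_nnreal_real.aemeasurable (fun t _ => hint 0 t) (.of_forall fun t => (κ t).coe_nonneg)
  simp only [ENNReal.ofReal_coe_nnreal] at hcake
  rw [← hcake]
  refine lintegral_congr fun ω => ?_
  rw [intervalIntegral.integral_of_le (f ω).coe_nonneg, integral_Ioc_eq_integral_Ioo,
    ofReal_integral_eq_lintegral_ofReal
      ((intervalIntegrable_iff_integrableOn_Ioo_of_le (f ω).coe_nonneg).1 (hint _ _))
      (.of_forall fun t => (κ t).coe_nonneg)]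
  simp only [ENNReal.ofReal_coe_nnreal]

theorem lintegral_tsub_eq_setLIntegral_Ioi (hf : Measurable f) (s : ℝ≥0) :
    ∫⁻ ω, ((f ω : ℝ≥0∞) - s) ∂μ = ∫⁻ t in Ioi (s : ℝ), μ {ω | t < f ω} := by
  have hκ : Monotone ((Ioi (s : ℝ)).indicator (1 : ℝ → ℝ≥0)) := fun a b hab => by
    by_cases ha : a ∈ Ioi (s : ℝ)
    · have hb : b ∈ Ioi (s : ℝ) := lt_of_lt_of_le ha hab
      simp only [indicator_of_mem ha, indicator_of_mem hb, Pi.one_apply, le_refl]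
    · simp only [indicator_of_notMem ha, zero_le]
  have hcoe : ∀ t : ℝ, (((Ioi (s : ℝ)).indicator 1 t : ℝ≥0) : ℝ≥0∞) =
      (Ioi (s : ℝ)).indicator 1 t := fun t => by
    by_cases ht : t ∈ Ioi (s : ℝ) <;> simp [ht]
  have hcake := lintegral_setLIntegral_Ioo_eq (μ := μ) hf hκ
  simp only [hcoe] at hcake
  calc ∫⁻ ω, ((f ω : ℝ≥0∞) - s) ∂μ
      = ∫⁻ ω, (∫⁻ t in Ioo 0 (f ω : ℝ), (Ioi (s : ℝ)).indicator 1 t) ∂μ := by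
        refine lintegral_congr fun ω => ?_
        rw [lintegral_indicator_one measurableSet_Ioi, Measure.restrict_apply measurableSet_Ioi,
          inter_comm, Ioo_inter_Ioi, max_eq_right s.coe_nonneg, Real.volume_Ioo,
          ENNReal.ofReal_sub _ s.coe_nonneg, ENNReal.ofReal_coe_nnreal, ENNReal.ofReal_coe_nnreal]
    _ = ∫⁻ t in Ioi (0 : ℝ), (Ioi (s : ℝ)).indicator (fun t => μ {ω | t < f ω}) t := by
        rw [hcake]
        refine lintegral_congr fun t => ?_
        by_cases ht : t ∈ Ioi (s : ℝ) <;> simp [ht]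
    _ = ∫⁻ t in Ioi (s : ℝ), μ {ω | t < f ω} := by
        rw [setLIntegral_indicator measurableSet_Ioi,
          inter_eq_left.2 (Ioi_subset_Ioi s.coe_nonneg)]

theorem lintegral_setLIntegral_Ioo_le (hf : Measurable f) (hg : Measurable g)
    (h : ∀ s : ℝ≥0, ∫⁻ ω, ((f ω : ℝ≥0∞) - s) ∂μ ≤ ∫⁻ ω, ((g ω : ℝ≥0∞) - s) ∂μ)
    {κ : ℝ → ℝ≥0} (hκ : Monotone κ) :
    ∫⁻ ω, (∫⁻ t in Ioo 0 (f ω : ℝ), κ t) ∂μ ≤ ∫⁻ ω, (∫⁻ t in Ioo 0 (g ω : ℝ), κ t) ∂μ := by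
  have hdistr : ∀ k : Ω → ℝ≥0, Measurable fun t : ℝ => μ {ω | t < k ω} := fun k =>
    Antitone.measurable fun _ _ hst => measure_mono fun _ hω => hst.trans_lt hω
  rw [lintegral_setLIntegral_Ioo_eq hf hκ, lintegral_setLIntegral_Ioo_eq hg hκ]
  refine setLIntegral_mul_le_of_monotone (hdistr f) (hdistr g) (fun s => ?_) hκ
  rw [← lintegral_tsub_eq_setLIntegral_Ioi hf, ← lintegral_tsub_eq_setLIntegral_Ioi hg]
  exact h s

theorem lintegral_convex_comp_le {ψ : ℝ≥0 → ℝ≥0∞} (hm : Monotone ψ) (hc : ConvexOn ℝ≥0 univ ψ)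
    (h0 : ψ 0 = 0) (hl : IsLeftContinuous ψ) (hf : Measurable f) (hg : Measurable g)
    (h : ∀ s : ℝ≥0, ∫⁻ ω, ((f ω : ℝ≥0∞) - s) ∂μ ≤ ∫⁻ ω, ((g ω : ℝ≥0∞) - s) ∂μ) :
    ∫⁻ ω, ψ (f ω) ∂μ ≤ ∫⁻ ω, ψ (g ω) ∂μ := by
  set D := extendedRightDeriv ψ
  have hD : Monotone D := monotone_extendedRightDeriv hm hc
  set κ : ℕ → ℝ → ℝ≥0 := fun n t => (min (D t) n).toNNReal
  have hκ : ∀ n t, (κ n t : ℝ≥0∞) = min (D t) n := fun n t =>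
    ENNReal.coe_toNNReal (min_lt_of_right_lt (ENNReal.natCast_lt_top n)).ne
  have hκ_mono : ∀ n, Monotone (κ n) := fun n s t hst => by
    rw [← ENNReal.coe_le_coe, hκ, hκ]
    exact min_le_min_right _ (hD hst)
  have hκ_mono' : Monotone fun n t => (κ n t : ℝ≥0∞) := fun m n hmn t => by
    simp only [hκ]
    exact min_le_min_left _ (by exact_mod_cast hmn)
  have hκ_sup : ∀ t, ⨆ n, (κ n t : ℝ≥0∞) = D t := fun t => by
    simp only [hκ, ← inf_iSup_eq, ENNReal.iSup_natCast, inf_top_eq]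
  have hψ : ∀ u : ℝ≥0, ψ u = ⨆ n, ∫⁻ t in Ioo 0 (u : ℝ), κ n t := fun u => by
    rw [eq_lintegral_extendedRightDeriv hm hc h0 hl,
      ← lintegral_iSup (fun n => (hκ_mono n).measurable.coe_nnreal_ennreal) hκ_mono']
    simp only [hκ_sup, D]
  have hmeas : ∀ n, Measurable fun u : ℝ≥0 => ∫⁻ t in Ioo 0 (u : ℝ), κ n t := fun n =>
    Monotone.measurable fun _ _ huv =>
      lintegral_mono_set (Ioo_subset_Ioo_right (NNReal.coe_le_coe.2 huv))
  simp only [hψ]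
  rw [lintegral_iSup (f := fun n ω => ∫⁻ t in Ioo 0 (f ω : ℝ), (κ n t : ℝ≥0∞))
      (fun n => (hmeas n).comp hf) fun m n hmn ω => lintegral_mono fun t => hκ_mono' hmn t]
  refine iSup_le fun n => (lintegral_setLIntegral_Ioo_le hf hg h (hκ_mono n)).trans ?_
  exact lintegral_mono fun ω => le_iSup (fun n => ∫⁻ t in Ioo 0 (g ω : ℝ), (κ n t : ℝ≥0∞)) n

end HingeDomination

/-! ### Radial truncation -/

section RadialTruncation

variable {Ω : Type*} [MeasurableSpace Ω] {𝕜 : Type*} [RCLike 𝕜] {μ : Measure Ω}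

theorem nnnorm_nnreal_smul (c : ℝ≥0) (z : 𝕜) : ‖c • z‖₊ = c * ‖z‖₊ := by
  rw [NNReal.smul_def, nnnorm_smul, NNReal.nnnorm_eq]

/-- The radial projection of a scalar onto the ball of radius `l`. The denominator makes the formula
total, the value at `l = 0` being `0`. -/
noncomputable def scalarTrunc (l : ℝ≥0) (z : 𝕜) : 𝕜 := (l / max l ‖z‖₊) • z

theorem nnnorm_scalarTrunc_le (l : ℝ≥0) (z : 𝕜) : ‖scalarTrunc l z‖₊ ≤ l := by
  rw [scalarTrunc, nnnorm_nnreal_smul, div_mul_eq_mul_div]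
  exact div_le_of_le_mul₀ zero_le zero_le (by gcongr; exact le_max_right _ _)

theorem nnnorm_sub_scalarTrunc_le (l : ℝ≥0) (z : 𝕜) : ‖z - scalarTrunc l z‖₊ ≤ ‖z‖₊ - l := by
  rcases eq_or_ne z 0 with rfl | hz
  · simp [scalarTrunc]
  have hz' : ‖z‖₊ ≠ 0 := nnnorm_ne_zero_iff.2 hz
  rcases le_total l ‖z‖₊ with h | h
  · have hle : l / ‖z‖₊ ≤ 1 := div_le_one_of_le₀ h zero_le
    have hsub : z - scalarTrunc l z = (1 - l / ‖z‖₊) • z := by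
      rw [scalarTrunc, max_eq_right h, sub_eq_iff_eq_add, ← add_smul, tsub_add_cancel_of_le hle,
        one_smul]
    rw [hsub, nnnorm_nnreal_smul, tsub_mul, one_mul, div_mul_cancel₀ _ hz']
  · have hl : l ≠ 0 := (hz'.bot_lt.trans_le h).ne'
    simp [scalarTrunc, max_eq_left h, div_self hl]

theorem measurable_scalarTrunc (l : ℝ≥0) : Measurable (scalarTrunc l : 𝕜 → 𝕜) := by
  unfold scalarTrunc
  fun_prop

/-- The pointwise radial projection of a function onto the ball of radius `l`: the bounded part of
the function at the level `l`. -/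
noncomputable def radialTrunc (l : ℝ≥0) (x : Ω →ₘ[μ] 𝕜) : Ω →ₘ[μ] 𝕜 :=
  AEEqFun.mk (fun t => scalarTrunc l (x t))
    ((measurable_scalarTrunc l).comp x.measurable).aestronglyMeasurable

theorem coeFn_radialTrunc (l : ℝ≥0) (x : Ω →ₘ[μ] 𝕜) :
    radialTrunc l x =ᵐ[μ] fun t => scalarTrunc l (x t) :=
  AEEqFun.coeFn_mk _ _

theorem eLpNorm_top_radialTrunc_le (l : ℝ≥0) (x : Ω →ₘ[μ] 𝕜) :
    eLpNorm (radialTrunc l x) ⊤ μ ≤ l := by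
  rw [eLpNorm_exponent_top]
  refine eLpNormEssSup_le_of_ae_nnnorm_bound ?_
  filter_upwards [coeFn_radialTrunc l x] with t ht
  rw [ht]
  exact nnnorm_scalarTrunc_le l _

theorem radialTrunc_mem_lebesgue_top (l : ℝ≥0) (x : Ω →ₘ[μ] 𝕜) :
    radialTrunc l x ∈ (FnSpace.lebesgue 𝕜 μ ⊤).carrier :=
  Lp.mem_Lp_iff_eLpNorm_lt_top.2 ((eLpNorm_top_radialTrunc_le l x).trans_lt ENNReal.coe_lt_top)

theorem ae_nnnorm_sub_radialTrunc_le (l : ℝ≥0) (x : Ω →ₘ[μ] 𝕜) :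
    ∀ᵐ t ∂μ, ‖(x - radialTrunc l x) t‖₊ ≤ ‖x t‖₊ - l := by
  filter_upwards [coeFn_radialTrunc l x, AEEqFun.coeFn_sub x (radialTrunc l x)] with t ht h
  rw [h, Pi.sub_apply, ht]
  exact nnnorm_sub_scalarTrunc_le l _

theorem tsub_rpow_le {p : ℝ} (hp : 1 ≤ p) (a l : ℝ≥0) : (a - l) ^ p ≤ a ^ p - l ^ p := by
  rcases le_total a l with h | h
  · rw [tsub_eq_zero_of_le h, NNReal.zero_rpow (zero_lt_one.trans_le hp).ne']
    exact zero_le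
  · refine le_tsub_of_add_le_right ((NNReal.add_rpow_le_rpow_add _ _ hp).trans_eq ?_)
    rw [tsub_add_cancel_of_le h]

theorem eLpNorm_sub_radialTrunc_rpow_le {p : ℝ≥0} (hp : 1 ≤ p) (l : ℝ≥0) (x : Ω →ₘ[μ] 𝕜) :
    eLpNorm (x - radialTrunc l x) p μ ^ (p : ℝ) ≤
      ∫⁻ t, (((‖x t‖₊ ^ (p : ℝ) : ℝ≥0) : ℝ≥0∞) - (l ^ (p : ℝ) : ℝ≥0)) ∂μ := by
  rw [eLpNorm_nnreal_pow_eq_lintegral (zero_lt_one.trans_le hp).ne']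
  refine lintegral_mono_ae ?_
  filter_upwards [ae_nnnorm_sub_radialTrunc_le l x] with t ht
  rw [enorm_eq_nnnorm, ← ENNReal.coe_rpow_of_nonneg _ p.coe_nonneg, ← ENNReal.coe_sub,
    ENNReal.coe_le_coe]
  exact (NNReal.rpow_le_rpow ht p.coe_nonneg).trans (tsub_rpow_le hp _ _)

end RadialTruncation

/-! ### Endpoint bounds of admissible operators -/

namespace FnSpace

section EndpointBounds

variable {Ω : Type*} [MeasurableSpace Ω] {𝕜 : Type*} [RCLike 𝕜] {μ : Measure Ω}

theorem zero_mem_lebesgue (q : ℝ≥0∞) : 0 ∈ (lebesgue 𝕜 μ q).carrier :=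
  (Lp 𝕜 q μ).zero_mem

theorem left_subset_sum {X₀ X₁ : FnSpace 𝕜 μ} (h : 0 ∈ X₁.carrier) : X₀.carrier ⊆ sum X₀ X₁ :=
  fun x hx => ⟨x, hx, 0, h, add_zero x⟩

theorem right_subset_sum {X₀ X₁ : FnSpace 𝕜 μ} (h : 0 ∈ X₀.carrier) : X₁.carrier ⊆ sum X₀ X₁ :=
  fun x hx => ⟨0, h, x, hx, zero_add x⟩

variable {X₀ X₁ : FnSpace 𝕜 μ} {T : sum X₀ X₁ → sum X₀ X₁} {q : ℝ≥0∞} {x y z : sum X₀ X₁}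

theorem nrm_apply_le_opNrm_mul {X : FnSpace 𝕜 μ} (hx : x.1 ∈ X.carrier) (hx0 : x.1 ≠ 0)
    (h0 : X.nrm x.1 ≠ 0) (htop : X.nrm x.1 ≠ ⊤) : X.nrm (T x).1 ≤ opNrm T X * X.nrm x.1 :=
  (ENNReal.div_le_iff h0 htop).1 <| le_iSup_of_le x <| le_iSup₂_of_le hx hx0 le_rfl

theorem eLpNorm_ne_zero_of_ne_zero (hq : q ≠ 0) {x : Ω →ₘ[μ] 𝕜} (hx : x ≠ 0) :
    eLpNorm x q μ ≠ 0 := by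
  rw [Ne, eLpNorm_eq_zero_iff x.aestronglyMeasurable hq]
  exact fun h => hx (AEEqFun.ext (h.trans AEEqFun.coeFn_zero.symm))

theorem eLpNorm_apply_le_of_ne_zero (hq : q ≠ 0) (hx : x.1 ∈ (lebesgue 𝕜 μ q).carrier)
    (hx0 : x.1 ≠ 0) : eLpNorm (T x).1 q μ ≤ opNrm T (lebesgue 𝕜 μ q) * eLpNorm x.1 q μ :=
  nrm_apply_le_opNrm_mul (X := lebesgue 𝕜 μ q) hx hx0 (eLpNorm_ne_zero_of_ne_zero hq hx0)
    (Lp.mem_Lp_iff_eLpNorm_lt_top.1 hx).ne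

theorem eLpNorm_apply_le_add (hT : IsSubadditive T) (hq : 1 ≤ q) (h : z.1 = x.1 + y.1) :
    eLpNorm (T z).1 q μ ≤ eLpNorm (T x).1 q μ + eLpNorm (T y).1 q μ :=
  calc eLpNorm (T z).1 q μ
      ≤ eLpNorm ((fun t => ‖(T x).1 t‖) + fun t => ‖(T y).1 t‖) q μ :=
        eLpNorm_mono_ae ((hT x y z h).mono fun t ht => ht.trans (le_abs_self _))
    _ ≤ eLpNorm (fun t => ‖(T x).1 t‖) q μ + eLpNorm (fun t => ‖(T y).1 t‖) q μ :=
        eLpNorm_add_le (T x).1.aestronglyMeasurable.norm (T y).1.aestronglyMeasurable.norm hq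
    _ = eLpNorm (T x).1 q μ + eLpNorm (T y).1 q μ := by rw [eLpNorm_norm, eLpNorm_norm]

theorem eLpNorm_real_smul (c : ℝ) (x : Ω →ₘ[μ] 𝕜) :
    eLpNorm (c • x : Ω →ₘ[μ] 𝕜) q μ = ‖c‖ₑ * eLpNorm x q μ := by
  rw [eLpNorm_congr_ae (AEEqFun.coeFn_smul c x), eLpNorm_const_smul]

theorem eLpNorm_apply_zero_le (hT : IsSubadditive T) (hq : 1 ≤ q)
    (hsub : (lebesgue 𝕜 μ q).carrier ⊆ sum X₀ X₁) (hx : x.1 = 0) {w : Ω →ₘ[μ] 𝕜}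
    (hw : w ∈ (lebesgue 𝕜 μ q).carrier) (hw0 : w ≠ 0) {c : ℝ} (hc : c ≠ 0) :
    eLpNorm (T x).1 q μ ≤ ‖c‖ₑ * (2 * (opNrm T (lebesgue 𝕜 μ q) * eLpNorm w q μ)) := by
  have hmem : ∀ a : ℝ, a • w ∈ (lebesgue 𝕜 μ q).carrier := fun a =>
    Lp.mem_Lp_iff_eLpNorm_lt_top.2 <| (eLpNorm_real_smul a w).trans_lt
      (ENNReal.mul_lt_top enorm_lt_top (Lp.mem_Lp_iff_eLpNorm_lt_top.1 hw))
  let v : ℝ → sum X₀ X₁ := fun a => ⟨a • w, hsub (hmem a)⟩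
  have hbound : ∀ a : ℝ, a ≠ 0 →
      eLpNorm (T (v a)).1 q μ ≤ ‖a‖ₑ * (opNrm T (lebesgue 𝕜 μ q) * eLpNorm w q μ) := fun a ha => by
    refine (eLpNorm_apply_le_of_ne_zero (x := v a) (zero_lt_one.trans_le hq).ne' (hmem a)
      (smul_ne_zero ha hw0)).trans_eq ?_
    rw [eLpNorm_real_smul, mul_left_comm]
  have hsplit : x.1 = (v c).1 + (v (-c)).1 :=
    calc x.1 = (c + -c) • w := by rw [hx, add_neg_cancel]; exact (zero_smul ℝ w).symm
      _ = c • w + (-c) • w := add_smul c (-c) w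
  calc eLpNorm (T x).1 q μ
      ≤ eLpNorm (T (v c)).1 q μ + eLpNorm (T (v (-c))).1 q μ := eLpNorm_apply_le_add hT hq hsplit
    _ ≤ ‖c‖ₑ * (opNrm T (lebesgue 𝕜 μ q) * eLpNorm w q μ) +
          ‖-c‖ₑ * (opNrm T (lebesgue 𝕜 μ q) * eLpNorm w q μ) :=
        add_le_add (hbound c hc) (hbound (-c) (neg_ne_zero.2 hc))
    _ = ‖c‖ₑ * (2 * (opNrm T (lebesgue 𝕜 μ q) * eLpNorm w q μ)) := by rw [enorm_neg]; ring

-- The previous bound with `w = T 0` and `c` small forces `‖w‖ < ‖w‖` unless `w = 0`.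
theorem apply_eq_zero_of_eq_zero (hT : IsSubadditive T) (hq : 1 ≤ q)
    (hsub : (lebesgue 𝕜 μ q).carrier ⊆ sum X₀ X₁) (hmap : MapsInto T (lebesgue 𝕜 μ q))
    (hbdd : opNrm T (lebesgue 𝕜 μ q) < ⊤) (hx : x.1 = 0) : (T x).1 = 0 := by
  by_contra hw
  have hmem : (T x).1 ∈ (lebesgue 𝕜 μ q).carrier := hmap x (hx ▸ zero_mem_lebesgue q)
  have htop : 2 * (opNrm T (lebesgue 𝕜 μ q) * eLpNorm (T x).1 q μ) ≠ ⊤ :=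
    ENNReal.mul_ne_top ENNReal.ofNat_ne_top
      (ENNReal.mul_ne_top hbdd.ne (Lp.mem_Lp_iff_eLpNorm_lt_top.1 hmem).ne)
  obtain ⟨c, hc, hlt⟩ := ENNReal.exists_nnreal_pos_mul_lt htop
    (eLpNorm_ne_zero_of_ne_zero (zero_lt_one.trans_le hq).ne' hw)
  have hle := eLpNorm_apply_zero_le hT hq hsub hx hmem hw (NNReal.coe_ne_zero.2 hc.ne')
  rw [enorm_eq_nnnorm, NNReal.nnnorm_eq] at hle
  exact hlt.not_ge hle

theorem eLpNorm_apply_le (hT : IsSubadditive T) (hq : 1 ≤ q)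
    (hsub : (lebesgue 𝕜 μ q).carrier ⊆ sum X₀ X₁) (hmap : MapsInto T (lebesgue 𝕜 μ q))
    (hbdd : opNrm T (lebesgue 𝕜 μ q) < ⊤) (hx : x.1 ∈ (lebesgue 𝕜 μ q).carrier) :
    eLpNorm (T x).1 q μ ≤ opNrm T (lebesgue 𝕜 μ q) * eLpNorm x.1 q μ := by
  rcases eq_or_ne x.1 0 with hx0 | hx0
  · rw [apply_eq_zero_of_eq_zero hT hq hsub hmap hbdd hx0, eLpNorm_congr_ae AEEqFun.coeFn_zero,
      eLpNorm_zero]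
    exact zero_le
  · exact eLpNorm_apply_le_of_ne_zero (zero_lt_one.trans_le hq).ne' hx hx0

end EndpointBounds

end FnSpace

/-! ### The modular estimate -/

theorem div_two_rpow_mul_rpow_le {p : ℝ} (hp : 1 ≤ p) {K w a b l : ℝ≥0} (hK : 0 < K)
    (hw : w ≤ a + b) (hb : b ≤ K * l) :
    (w / (2 ^ (1 - 1 / p) * K)) ^ p ≤ (a / K) ^ p + l ^ p := by
  have hle : w / K ≤ a / K + l := by
    rw [div_le_iff₀ hK, add_mul, div_mul_cancel₀ _ hK.ne', mul_comm l]
    exact hw.trans (by gcongr)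
  have hexp : ((2 : ℝ≥0) ^ (1 - 1 / p)) ^ p = 2 ^ (p - 1) := by
    rw [← NNReal.rpow_mul, sub_mul, one_mul, one_div_mul_cancel (zero_lt_one.trans_le hp).ne']
  rw [mul_comm, ← div_div, NNReal.div_rpow, hexp, div_le_iff₀ (NNReal.rpow_pos two_pos), mul_comm]
  exact (NNReal.rpow_le_rpow hle (zero_le_one.trans hp)).trans
    (NNReal.rpow_add_le_mul_rpow_add_rpow _ _ hp)

theorem rpow_one_div_rpow {p : ℝ} (hp : p ≠ 0) (a : ℝ≥0) : (a ^ (1 / p)) ^ p = a := by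
  rw [← NNReal.rpow_mul, one_div_mul_cancel hp, NNReal.rpow_one]

theorem rpow_rpow_one_div {p : ℝ} (hp : p ≠ 0) (a : ℝ≥0) : (a ^ p) ^ (1 / p) = a := by
  rw [← NNReal.rpow_mul, mul_one_div_cancel hp, NNReal.rpow_one]

section ModularEstimate

variable {Ω : Type*} [MeasurableSpace Ω] {𝕜 : Type*} [RCLike 𝕜] {μ : Measure Ω}

theorem lintegral_rpow_tsub_le_of_nnnorm_le_add {p : ℝ≥0} (hp : 1 ≤ p) {K l : ℝ≥0} (hK : 0 < K)
    {w a b : Ω → 𝕜} (hw : ∀ᵐ t ∂μ, ‖w t‖ ≤ ‖a t‖ + ‖b t‖) (hb : ∀ᵐ t ∂μ, ‖b t‖₊ ≤ K * l) :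
    ∫⁻ t, ((((‖w t‖₊ / (2 ^ (1 - 1 / (p : ℝ)) * K)) ^ (p : ℝ) : ℝ≥0) : ℝ≥0∞) -
      (l ^ (p : ℝ) : ℝ≥0)) ∂μ ≤ ((K : ℝ≥0∞)⁻¹ * eLpNorm a p μ) ^ (p : ℝ) := by
  have hscale : ∀ t, (((‖a t‖₊ / K) ^ (p : ℝ) : ℝ≥0) : ℝ≥0∞) =
      (K : ℝ≥0∞)⁻¹ ^ (p : ℝ) * ‖a t‖ₑ ^ (p : ℝ) := fun t => by
    rw [ENNReal.coe_rpow_of_nonneg _ p.coe_nonneg, ENNReal.coe_div hK.ne', ENNReal.div_eq_inv_mul,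
      ENNReal.mul_rpow_of_nonneg _ _ p.coe_nonneg, enorm_eq_nnnorm]
  calc _ ≤ ∫⁻ t, (((‖a t‖₊ / K) ^ (p : ℝ) : ℝ≥0) : ℝ≥0∞) ∂μ := by
        refine lintegral_mono_ae ?_
        filter_upwards [hw, hb] with t htw htb
        rw [← ENNReal.coe_sub, ENNReal.coe_le_coe, tsub_le_iff_right]
        exact div_two_rpow_mul_rpow_le hp hK htw htb
    _ = (K : ℝ≥0∞)⁻¹ ^ (p : ℝ) * ∫⁻ t, ‖a t‖ₑ ^ (p : ℝ) ∂μ := by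
        simp only [hscale]
        exact lintegral_const_mul' _ _ (by finiteness)
    _ = ((K : ℝ≥0∞)⁻¹ * eLpNorm a p μ) ^ (p : ℝ) := by
        rw [ENNReal.mul_rpow_of_nonneg _ _ p.coe_nonneg,
          eLpNorm_nnreal_pow_eq_lintegral (zero_lt_one.trans_le hp).ne']

namespace FnSpace

variable {p : ℝ≥0} {T : sum (lebesgue 𝕜 μ p) (lebesgue 𝕜 μ ⊤) →
  sum (lebesgue 𝕜 μ p) (lebesgue 𝕜 μ ⊤)} {x : sum (lebesgue 𝕜 μ p) (lebesgue 𝕜 μ ⊤)} {K : ℝ≥0}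

theorem IsAdmissible.eLpNorm_apply_le (hp : 1 ≤ p) (hT : IsAdmissible T) (hM : maxNrm T ≤ K)
    (hx : x.1 ∈ (lebesgue 𝕜 μ p).carrier) : eLpNorm (T x).1 p μ ≤ K * eLpNorm x.1 p μ :=
  (FnSpace.eLpNorm_apply_le hT.subadditive (by exact_mod_cast hp)
    (left_subset_sum (zero_mem_lebesgue ⊤)) hT.mapsInto₀ hT.bounded₀ hx).trans <|
      mul_le_mul_left ((le_max_left _ _).trans hM) _

theorem IsAdmissible.eLpNorm_top_apply_le (hT : IsAdmissible T) (hM : maxNrm T ≤ K)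
    (hx : x.1 ∈ (lebesgue 𝕜 μ ⊤).carrier) : eLpNorm (T x).1 ⊤ μ ≤ K * eLpNorm x.1 ⊤ μ :=
  (FnSpace.eLpNorm_apply_le hT.subadditive le_top
    (right_subset_sum (zero_mem_lebesgue _)) hT.mapsInto₁ hT.bounded₁ hx).trans <|
      mul_le_mul_left ((le_max_right _ _).trans hM) _

theorem IsAdmissible.ae_nnnorm_apply_le (hT : IsAdmissible T) (hM : maxNrm T ≤ K) {l : ℝ≥0}
    (hx : eLpNorm x.1 ⊤ μ ≤ l) : ∀ᵐ t ∂μ, ‖(T x).1 t‖₊ ≤ K * l := by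
  have hle : eLpNormEssSup (T x).1 μ ≤ ((K * l : ℝ≥0) : ℝ≥0∞) := by
    rw [← eLpNorm_exponent_top, ENNReal.coe_mul]
    exact (hT.eLpNorm_top_apply_le hM (Lp.mem_Lp_iff_eLpNorm_lt_top.2
      (hx.trans_lt ENNReal.coe_lt_top))).trans (by gcongr)
  filter_upwards [enorm_ae_le_eLpNormEssSup (T x).1 μ] with t ht
  exact ENNReal.coe_le_coe.1 (ht.trans hle)

theorem IsAdmissible.lintegral_rpow_tsub_le (hp : 1 ≤ p) (hT : IsAdmissible T) (hK : 0 < K)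
    (hM : maxNrm T ≤ K) (x : sum (lebesgue 𝕜 μ p) (lebesgue 𝕜 μ ⊤)) (l : ℝ≥0) :
    ∫⁻ t, ((((‖(T x).1 t‖₊ / (2 ^ (1 - 1 / (p : ℝ)) * K)) ^ (p : ℝ) : ℝ≥0) : ℝ≥0∞) -
        (l ^ (p : ℝ) : ℝ≥0)) ∂μ ≤
      ∫⁻ t, (((‖x.1 t‖₊ ^ (p : ℝ) : ℝ≥0) : ℝ≥0∞) - (l ^ (p : ℝ) : ℝ≥0)) ∂μ := by
  refine le_trans ?_ (eLpNorm_sub_radialTrunc_rpow_le hp l x.1)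
  by_cases hfin : eLpNorm (x.1 - radialTrunc l x.1) p μ = ⊤
  · rw [hfin, ENNReal.top_rpow_of_pos (NNReal.coe_pos.2 (zero_lt_one.trans_le hp))]
    exact le_top
  have hmem : x.1 - radialTrunc l x.1 ∈ (lebesgue 𝕜 μ p).carrier :=
    Lp.mem_Lp_iff_eLpNorm_lt_top.2 (Ne.lt_top hfin)
  let tail : sum (lebesgue 𝕜 μ p) (lebesgue 𝕜 μ ⊤) :=
    ⟨x.1 - radialTrunc l x.1, left_subset_sum (zero_mem_lebesgue ⊤) hmem⟩
  let trunc : sum (lebesgue 𝕜 μ p) (lebesgue 𝕜 μ ⊤) :=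
    ⟨radialTrunc l x.1, right_subset_sum (zero_mem_lebesgue _) (radialTrunc_mem_lebesgue_top l x.1)⟩
  refine (lintegral_rpow_tsub_le_of_nnnorm_le_add hp hK
    (hT.subadditive tail trunc x (sub_add_cancel _ _).symm)
    (hT.ae_nnnorm_apply_le hM (eLpNorm_top_radialTrunc_le l x.1))).trans ?_
  refine ENNReal.rpow_le_rpow ?_ p.coe_nonneg
  rw [← ENNReal.div_eq_inv_mul]
  exact ENNReal.div_le_of_le_mul' (hT.eLpNorm_apply_le (x := tail) hp hM hmem)

end FnSpace

theorem modular_nnreal_smul (φ : ℝ≥0 → ℝ≥0∞) (c : ℝ≥0) (x : Ω →ₘ[μ] 𝕜) :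
    modular φ (c • x) = ∫⁻ t, φ (c * ‖x t‖₊) ∂μ := by
  refine lintegral_congr_ae ((AEEqFun.coeFn_smul c x).mono fun t ht => ?_)
  simp only [ht, Pi.smul_apply, nnnorm_nnreal_smul]

theorem IsLeftContinuous.comp_strictMono {φ : ℝ≥0 → ℝ≥0∞} (hφ : IsLeftContinuous φ) {h : ℝ≥0 → ℝ≥0}
    (hmono : StrictMono h) (hcont : Continuous h) : IsLeftContinuous (φ ∘ h) := fun u =>
  (hφ (h u)).comp hcont.continuousWithinAt fun _ hv => hmono hv

variable {φ : ℝ≥0 → ℝ≥0∞} {p : ℝ≥0}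
  {T : FnSpace.sum (FnSpace.lebesgue 𝕜 μ p) (FnSpace.lebesgue 𝕜 μ ⊤) →
    FnSpace.sum (FnSpace.lebesgue 𝕜 μ p) (FnSpace.lebesgue 𝕜 μ ⊤)} {K : ℝ≥0}

theorem modular_inv_smul_apply_le (hp : 1 ≤ p) (hm : Monotone φ) (h0 : φ 0 = 0)
    (hl : IsLeftContinuous φ) (hc : ConvexOn ℝ≥0 univ (fun u : ℝ≥0 => φ (u ^ (1 / (p : ℝ)))))
    (hT : FnSpace.IsAdmissible T) (hK : 0 < K) (hM : FnSpace.maxNrm T ≤ K)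
    (x : FnSpace.sum (FnSpace.lebesgue 𝕜 μ p) (FnSpace.lebesgue 𝕜 μ ⊤)) :
    modular φ ((2 ^ (1 - 1 / (p : ℝ)) * K)⁻¹ • (T x).1) ≤ modular φ x.1 := by
  have hp0 : (p : ℝ) ≠ 0 := NNReal.coe_ne_zero.2 (zero_lt_one.trans_le hp).ne'
  have hip : 0 < 1 / (p : ℝ) := one_div_pos.2 (zero_lt_one.trans_le hp)
  have hdom : ∀ s : ℝ≥0,
      ∫⁻ t, ((((‖(T x).1 t‖₊ / (2 ^ (1 - 1 / (p : ℝ)) * K)) ^ (p : ℝ) : ℝ≥0) : ℝ≥0∞) - s) ∂μ ≤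
        ∫⁻ t, (((‖x.1 t‖₊ ^ (p : ℝ) : ℝ≥0) : ℝ≥0∞) - s) ∂μ := fun s => by
    simpa only [rpow_one_div_rpow hp0] using
      hT.lintegral_rpow_tsub_le hp hK hM x (s ^ (1 / (p : ℝ)))
  have hle := lintegral_convex_comp_le (ψ := fun u => φ (u ^ (1 / (p : ℝ))))
    (fun a b hab => hm (NNReal.rpow_le_rpow hab hip.le)) hc (by rw [NNReal.zero_rpow hip.ne', h0])
    (hl.comp_strictMono (NNReal.strictMono_rpow_of_pos hip) (NNReal.continuous_rpow_const hip.le))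
    (((T x).1.measurable.nnnorm.div_const _).pow_const _) (x.1.measurable.nnnorm.pow_const _) hdom
  simp only [rpow_rpow_one_div hp0] at hle
  rw [modular_nnreal_smul, modular]
  simpa only [← div_eq_inv_mul] using hle

theorem modular_smul_inv_smul_apply_le (hp : 1 ≤ p) (hm : Monotone φ) (h0 : φ 0 = 0)
    (hl : IsLeftContinuous φ) (hc : ConvexOn ℝ≥0 univ (fun u : ℝ≥0 => φ (u ^ (1 / (p : ℝ)))))
    (hT : FnSpace.IsAdmissible T) (hK : 0 < K) (hM : FnSpace.maxNrm T ≤ K) {c : ℝ≥0} (hc0 : 0 < c)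
    (x : FnSpace.sum (FnSpace.lebesgue 𝕜 μ p) (FnSpace.lebesgue 𝕜 μ ⊤)) :
    modular φ (c • (2 ^ (1 - 1 / (p : ℝ)) * K)⁻¹ • (T x).1) ≤ modular φ (c • x.1) := by
  have hp0 : (p : ℝ) ≠ 0 := NNReal.coe_ne_zero.2 (zero_lt_one.trans_le hp).ne'
  have hconv : ConvexOn ℝ≥0 univ fun u : ℝ≥0 => φ (c * u ^ (1 / (p : ℝ))) := by
    have hcomp := hc.comp_linearMap (LinearMap.lsmul ℝ≥0 ℝ≥0 (c ^ (p : ℝ)))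
    simpa only [preimage_univ, Function.comp_def, LinearMap.lsmul_apply, smul_eq_mul,
      NNReal.mul_rpow, rpow_rpow_one_div hp0] using hcomp
  have hscale : ∀ y : Ω →ₘ[μ] 𝕜, modular (fun u => φ (c * u)) y = modular φ (c • y) := fun y =>
    (modular_nnreal_smul φ c y).symm
  rw [← hscale, ← hscale]
  exact modular_inv_smul_apply_le hp (fun _ _ h => hm (by gcongr)) (by rw [mul_zero, h0])
    (hl.comp_strictMono (strictMono_mul_left_of_pos hc0) (continuous_const_mul c)) hconv hT hK hM x

end ModularEstimate

/-! ### Norms defined by a modular -/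

theorem map_nnreal_smul_le_of_convexOn {E : Type*} [AddCommMonoid E] [Module ℝ≥0 E] {f : E → ℝ≥0∞}
    (hf : ConvexOn ℝ≥0 univ f) (h0 : f 0 = 0) {a : ℝ≥0} (ha : a ≤ 1) (x : E) :
    f (a • x) ≤ a * f x := by
  have hconv := hf.2 (mem_univ x) (mem_univ 0) zero_le zero_le (add_tsub_cancel_of_le ha)
  rwa [smul_zero, add_zero, h0, smul_zero, add_zero, ENNReal.smul_def, smul_eq_mul] at hconv

theorem IsOrliczFunction.exists_le {φ : ℝ≥0 → ℝ≥0∞} (hφ : IsOrliczFunction φ) (N : ℝ≥0) :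
    ∃ v : ℝ≥0, 0 < v ∧ (N : ℝ≥0∞) ≤ φ v := by
  obtain ⟨u, hu, hφu⟩ := hφ.not_zero
  obtain ⟨n, hn⟩ := ENNReal.exists_nat_mul_gt hφu (b := (N : ℝ≥0∞)) ENNReal.coe_ne_top
  have hn1 : (1 : ℝ≥0) ≤ n :=
    Nat.one_le_cast.2 (Nat.pos_of_ne_zero fun h => by simp [h] at hn)
  have hn0 : (n : ℝ≥0) ≠ 0 := (zero_lt_one.trans_le hn1).ne'
  refine ⟨n * u, mul_pos (zero_lt_one.trans_le hn1) hu, hn.le.trans ?_⟩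
  have hle := map_nnreal_smul_le_of_convexOn hφ.convex hφ.map_zero (inv_le_one_of_one_le₀ hn1)
    (n * u)
  rw [smul_eq_mul, inv_mul_cancel_left₀ hn0, ENNReal.coe_inv hn0, ← ENNReal.div_eq_inv_mul,
    ENNReal.le_div_iff_mul_le (.inl (ENNReal.coe_ne_zero.2 hn0)) (.inl ENNReal.coe_ne_top),
    mul_comm] at hle
  exact_mod_cast hle

/-- The functions `W` for which `⨅ l > 0, l * W (I_φ (x / l))` is a norm equivalent to the
Luxemburg–Nakano norm. -/
structure IsNormWeight (W : ℝ≥0∞ → ℝ≥0∞) : Prop where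
  map_zero : W 0 = 1
  mono : Monotone W
  self_le : ∀ a, a ≤ W a
  map_one_ne_top : W 1 ≠ ⊤
  convex : ConvexOn ℝ≥0 univ W

theorem IsNormWeight.one_le {W : ℝ≥0∞ → ℝ≥0∞} (hW : IsNormWeight W) (a : ℝ≥0∞) : 1 ≤ W a :=
  hW.map_zero.symm.trans_le (hW.mono zero_le)

/-- The weight of the Luxemburg–Nakano norm. -/
noncomputable def luxemburgWeight (a : ℝ≥0∞) : ℝ≥0∞ := if a ≤ 1 then 1 else ⊤

theorem convexOn_luxemburgWeight : ConvexOn ℝ≥0 univ luxemburgWeight := by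
  refine ⟨convex_univ, fun u _ v _ a b _ _ hab => ?_⟩
  have hab' : (a : ℝ≥0∞) + b = 1 := by exact_mod_cast hab
  simp only [luxemburgWeight, ENNReal.smul_def, smul_eq_mul]
  rcases eq_or_ne a 0 with rfl | ha
  · obtain rfl : b = 1 := by simpa using hab
    simp
  rcases eq_or_ne b 0 with rfl | hb
  · obtain rfl : a = 1 := by simpa using hab
    simp
  by_cases huv : u ≤ 1 ∧ v ≤ 1
  · have hle : (a : ℝ≥0∞) * u + b * v ≤ 1 := calc
      (a : ℝ≥0∞) * u + b * v ≤ a * 1 + b * 1 := by gcongr <;> simp only [huv]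
      _ = 1 := by rw [mul_one, mul_one, hab']
    simp [huv, hle, hab']
  · rcases not_and_or.1 huv with hu | hv
    · simp [hu, ENNReal.mul_top, ha]
    · simp [hv, ENNReal.mul_top, hb]

theorem isNormWeight_luxemburgWeight : IsNormWeight luxemburgWeight where
  map_zero := if_pos zero_le
  mono a b hab := by
    unfold luxemburgWeight
    split_ifs with ha hb hb
    · rfl
    · exact le_top
    · exact absurd (hab.trans hb) ha
    · rfl
  self_le a := by
    unfold luxemburgWeight
    split_ifs with ha
    exacts [ha, le_top]
  map_one_ne_top := by simp [luxemburgWeight]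
  convex := convexOn_luxemburgWeight

theorem isNormWeight_one_add : IsNormWeight fun a => 1 + a where
  map_zero := add_zero 1
  mono _ _ hab := add_le_add_right hab 1
  self_le _ := le_add_self
  map_one_ne_top := by simp
  convex := (convexOn_const 1 convex_univ).add (convexOn_id convex_univ)

section Norms

variable {Ω : Type*} [MeasurableSpace Ω] {𝕜 : Type*} [RCLike 𝕜] {μ : Measure Ω}
  {φ : ℝ≥0 → ℝ≥0∞} {W : ℝ≥0∞ → ℝ≥0∞}

theorem modular_zero (h0 : φ 0 = 0) : modular φ (0 : Ω →ₘ[μ] 𝕜) = 0 := by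
  refine (lintegral_congr_ae ((AEEqFun.coeFn_zero (β := 𝕜)).mono fun t ht => ?_)).trans
    lintegral_zero
  simp only [ht, Pi.zero_apply, nnnorm_zero, h0]

theorem modular_scalar_smul (φ : ℝ≥0 → ℝ≥0∞) (a : 𝕜) (x : Ω →ₘ[μ] 𝕜) :
    modular φ (a • x) = modular φ (‖a‖₊ • x) := by
  rw [modular_nnreal_smul]
  refine lintegral_congr_ae ((AEEqFun.coeFn_smul a x).mono fun t ht => ?_)
  simp only [ht, Pi.smul_apply, nnnorm_smul]

theorem modular_nnreal_smul_mono (hm : Monotone φ) (x : Ω →ₘ[μ] 𝕜) :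
    Monotone fun c : ℝ≥0 => modular φ (c • x) := fun c d hcd => by
  simp only [modular_nnreal_smul]
  exact lintegral_mono fun t => hm (by gcongr)

theorem convexOn_modular (hm : Monotone φ) (hc : ConvexOn ℝ≥0 univ φ) :
    ConvexOn ℝ≥0 univ (modular φ : (Ω →ₘ[μ] 𝕜) → ℝ≥0∞) := by
  refine ⟨convex_univ, fun x _ y _ a b _ _ hab => ?_⟩
  have hmeas : Measurable fun t => φ ‖x t‖₊ := hm.measurable.comp x.measurable.nnnorm
  simp only [modular, ENNReal.smul_def, smul_eq_mul]
  rw [← lintegral_const_mul' _ _ ENNReal.coe_ne_top, ← lintegral_const_mul' _ _ ENNReal.coe_ne_top,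
    ← lintegral_add_left (hmeas.const_mul _)]
  refine lintegral_mono_ae ?_
  filter_upwards [AEEqFun.coeFn_add (a • x) (b • y), AEEqFun.coeFn_smul a x,
    AEEqFun.coeFn_smul b y] with t hadd hx hy
  have hle : ‖(a • x + b • y) t‖₊ ≤ a • ‖x t‖₊ + b • ‖y t‖₊ := by
    rw [hadd, Pi.add_apply, hx, hy]
    refine (nnnorm_add_le _ _).trans_eq ?_
    simp only [Pi.smul_apply, nnnorm_nnreal_smul, smul_eq_mul]
  exact (hm hle).trans (hc.2 (mem_univ _) (mem_univ _) zero_le zero_le hab)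

theorem IsOrliczFunction.modular_nnreal_smul_le (hφ : IsOrliczFunction φ) {a : ℝ≥0} (ha : a ≤ 1)
    (x : Ω →ₘ[μ] 𝕜) : modular φ (a • x) ≤ a * modular φ x :=
  map_nnreal_smul_le_of_convexOn (convexOn_modular hφ.mono hφ.convex) (modular_zero hφ.map_zero)
    ha x

/-- The norm `⨅ l > 0, l * W (I_φ (x / l))` of the Orlicz space; the Luxemburg–Nakano norm
and the Orlicz norm are the instances `W = luxemburgWeight` and `W a = 1 + a`. -/
noncomputable def weightedNorm (φ : ℝ≥0 → ℝ≥0∞) (W : ℝ≥0∞ → ℝ≥0∞) (x : Ω →ₘ[μ] 𝕜) : ℝ≥0∞ :=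
  ⨅ (l : ℝ≥0) (_ : 0 < l), (l : ℝ≥0∞) * W (modular φ (l⁻¹ • x))

theorem weightedNorm_le (φ : ℝ≥0 → ℝ≥0∞) (W : ℝ≥0∞ → ℝ≥0∞) (x : Ω →ₘ[μ] 𝕜) {l : ℝ≥0}
    (hl : 0 < l) : weightedNorm φ W x ≤ l * W (modular φ (l⁻¹ • x)) :=
  iInf₂_le l hl

theorem le_mul_weightedNorm {x : Ω →ₘ[μ] 𝕜} {a C : ℝ≥0∞} (hC0 : C ≠ 0) (hC : C ≠ ⊤)
    (h : ∀ l : ℝ≥0, 0 < l → a ≤ C * (l * W (modular φ (l⁻¹ • x)))) :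
    a ≤ C * weightedNorm φ W x := by
  simp only [weightedNorm, ENNReal.mul_iInf_of_ne hC0 hC]
  exact le_iInf₂ h

theorem luxemburgNorm_eq_weightedNorm (φ : ℝ≥0 → ℝ≥0∞) (x : Ω →ₘ[μ] 𝕜) :
    luxemburgNorm φ x = weightedNorm φ luxemburgWeight x := by
  refine le_antisymm (le_iInf₂ fun l hl => ?_) (le_iInf₂ fun l hl => le_iInf fun hx => ?_)
  · unfold luxemburgWeight
    split_ifs with hx
    · exact iInf₂_le_of_le (l : ℝ) (NNReal.coe_pos.2 hl) (iInf_le_of_le hx (by simp))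
    · rw [ENNReal.mul_top (ENNReal.coe_ne_zero.2 hl.ne')]
      exact le_top
  · lift l to ℝ≥0 using hl.le
    refine (weightedNorm_le φ _ x (NNReal.coe_pos.1 hl)).trans_eq ?_
    have hle : modular φ (l⁻¹ • x) ≤ 1 := hx
    rw [luxemburgWeight, if_pos hle, mul_one, ENNReal.ofReal_coe_nnreal]

theorem orliczNorm_eq_weightedNorm (φ : ℝ≥0 → ℝ≥0∞) (x : Ω →ₘ[μ] 𝕜) :
    orliczNorm φ x = weightedNorm φ (fun a => 1 + a) x := by
  refine le_antisymm (le_iInf₂ fun l hl => ?_) (le_iInf₂ fun k hk => ?_)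
  · refine iInf₂_le_of_le ((l⁻¹ : ℝ≥0) : ℝ) (NNReal.coe_pos.2 (inv_pos.2 hl)) ?_
    rw [ENNReal.ofReal_coe_nnreal, ENNReal.coe_inv hl.ne', inv_inv]
    rfl
  · lift k to ℝ≥0 using hk.le
    have hk' : 0 < k := NNReal.coe_pos.1 hk
    refine (weightedNorm_le φ _ x (inv_pos.2 hk')).trans_eq ?_
    rw [ENNReal.ofReal_coe_nnreal, ENNReal.coe_inv hk'.ne', inv_inv]
    rfl

theorem luxemburgNorm_le {x : Ω →ₘ[μ] 𝕜} {l : ℝ≥0} (hl : 0 < l)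
    (h : modular φ (l⁻¹ • x) ≤ 1) : luxemburgNorm φ x ≤ l := by
  rw [luxemburgNorm_eq_weightedNorm]
  refine (weightedNorm_le φ _ x hl).trans_eq ?_
  rw [luxemburgWeight, if_pos h, mul_one]

theorem modular_le_one_of_luxemburgNorm_lt (hm : Monotone φ) {x : Ω →ₘ[μ] 𝕜} {l : ℝ≥0}
    (h : luxemburgNorm φ x < l) : modular φ (l⁻¹ • x) ≤ 1 := by
  simp only [luxemburgNorm, iInf_lt_iff] at h
  obtain ⟨k, hk, hle, hkl⟩ := h
  lift k to ℝ≥0 using hk.le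
  rw [ENNReal.ofReal_coe_nnreal, ENNReal.coe_lt_coe] at hkl
  exact (modular_nnreal_smul_mono hm x (inv_anti₀ (NNReal.coe_pos.1 hk) hkl.le)).trans hle

-- If `w` is the value of the weight at `I_φ(x / l)`, convexity gives `I_φ(x / (l w)) ≤ 1`.
theorem luxemburgNorm_le_weightedNorm (hφ : IsOrliczFunction φ) (hW : IsNormWeight W)
    (x : Ω →ₘ[μ] 𝕜) : luxemburgNorm φ x ≤ weightedNorm φ W x := by
  refine le_iInf₂ fun l hl => ?_
  rcases eq_or_ne (W (modular φ (l⁻¹ • x))) ⊤ with htop | hne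
  · rw [htop, ENNReal.mul_top (ENNReal.coe_ne_zero.2 hl.ne')]
    exact le_top
  have hone := hW.one_le (modular φ (l⁻¹ • x))
  have hself := hW.self_le (modular φ (l⁻¹ • x))
  lift W (modular φ (l⁻¹ • x)) to ℝ≥0 using hne with w
  have hw : 1 ≤ w := by exact_mod_cast hone
  have hw0 : 0 < w := zero_lt_one.trans_le hw
  rw [← ENNReal.coe_mul]
  refine luxemburgNorm_le (mul_pos hl hw0) ?_
  rw [mul_inv, mul_comm, mul_smul]
  refine (hφ.modular_nnreal_smul_le (inv_le_one_of_one_le₀ hw) _).trans ?_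
  rw [ENNReal.coe_inv hw0.ne', ← ENNReal.div_eq_inv_mul]
  exact ENNReal.div_le_of_le_mul (by rwa [one_mul])

theorem weightedNorm_le_mul_luxemburgNorm (hW : IsNormWeight W) (x : Ω →ₘ[μ] 𝕜) :
    weightedNorm φ W x ≤ W 1 * luxemburgNorm φ x := by
  have hW0 : W 1 ≠ 0 := (zero_lt_one.trans_le (hW.one_le 1)).ne'
  rw [luxemburgNorm_eq_weightedNorm]
  refine le_mul_weightedNorm hW0 hW.map_one_ne_top fun l hl => ?_
  unfold luxemburgWeight
  split_ifs with hx
  · rw [mul_one, mul_comm]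
    exact (weightedNorm_le φ W x hl).trans (by gcongr; exact hW.mono hx)
  · rw [ENNReal.mul_top (ENNReal.coe_ne_zero.2 hl.ne'), ENNReal.mul_top hW0]
    exact le_top

theorem weightedNorm_le_mul_weightedNorm (hW : Monotone W) {x y : Ω →ₘ[μ] 𝕜} {C : ℝ≥0} (hC : 0 < C)
    (h : ∀ c : ℝ≥0, 0 < c → modular φ (c • C⁻¹ • x) ≤ modular φ (c • y)) :
    weightedNorm φ W x ≤ C * weightedNorm φ W y := by
  refine le_mul_weightedNorm (ENNReal.coe_ne_zero.2 hC.ne') ENNReal.coe_ne_top fun l hl => ?_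
  refine (weightedNorm_le φ W x (mul_pos hC hl)).trans ?_
  rw [ENNReal.coe_mul, mul_assoc, mul_inv, mul_comm C⁻¹, mul_smul]
  gcongr
  exact hW (h _ (inv_pos.2 hl))

theorem weightedNorm_add_le (hφ : IsOrliczFunction φ) (hW : IsNormWeight W) (x y : Ω →ₘ[μ] 𝕜) :
    weightedNorm φ W (x + y) ≤ weightedNorm φ W x + weightedNorm φ W y := by
  suffices h : ∀ l : ℝ≥0, 0 < l → ∀ k : ℝ≥0, 0 < k → weightedNorm φ W (x + y) ≤
      l * W (modular φ (l⁻¹ • x)) + k * W (modular φ (k⁻¹ • y)) by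
    conv_rhs => unfold weightedNorm
    simp only [ENNReal.iInf_add, ENNReal.add_iInf]
    exact le_iInf₂ fun l hl => le_iInf₂ fun k hk => h _ ‹_› _ ‹_›
  intro l hl k hk
  have hlk : l + k ≠ 0 := (add_pos hl hk).ne'
  have hsum : l / (l + k) + k / (l + k) = 1 := by rw [← add_div, div_self hlk]
  have hcomb : (l + k)⁻¹ • (x + y) = (l / (l + k)) • l⁻¹ • x + (k / (l + k)) • k⁻¹ • y := by
    rw [smul_smul, smul_smul, smul_add]
    congr 2 <;> field_simp
  refine (weightedNorm_le φ W (x + y) (add_pos hl hk)).trans ?_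
  calc ((l + k : ℝ≥0) : ℝ≥0∞) * W (modular φ ((l + k)⁻¹ • (x + y)))
      ≤ (l + k : ℝ≥0) * ((l / (l + k)) • W (modular φ (l⁻¹ • x)) +
          (k / (l + k)) • W (modular φ (k⁻¹ • y))) := by
        rw [hcomb]
        gcongr
        exact (hW.mono ((convexOn_modular hφ.mono hφ.convex).2 (mem_univ _) (mem_univ _)
          zero_le zero_le hsum)).trans (hW.convex.2 (mem_univ _) (mem_univ _) zero_le zero_le hsum)
    _ = _ := by
        simp only [ENNReal.smul_def, smul_eq_mul]
        rw [mul_add, ← mul_assoc, ← mul_assoc, ← ENNReal.coe_mul, ← ENNReal.coe_mul,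
          mul_div_cancel₀ _ hlk, mul_div_cancel₀ _ hlk]

theorem weightedNorm_zero (hW : IsNormWeight W) (h0 : φ 0 = 0) :
    weightedNorm φ W (0 : Ω →ₘ[μ] 𝕜) = 0 := by
  refine le_antisymm (ENNReal.le_of_forall_pos_le_add fun ε hε _ => ?_) zero_le
  refine (weightedNorm_le φ W 0 hε).trans_eq ?_
  rw [show ε⁻¹ • (0 : Ω →ₘ[μ] 𝕜) = 0 from smul_zero (A := Ω →ₘ[μ] 𝕜) ε⁻¹, modular_zero h0,
    hW.map_zero, mul_one, zero_add]

theorem weightedNorm_smul_le (hW : Monotone W) {a : 𝕜} (ha : a ≠ 0) (x : Ω →ₘ[μ] 𝕜) :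
    weightedNorm φ W (a • x) ≤ ‖a‖ₑ * weightedNorm φ W x := by
  refine weightedNorm_le_mul_weightedNorm hW (nnnorm_pos.2 ha) fun c _ => le_of_eq ?_
  rw [smul_smul, smul_comm, modular_scalar_smul, smul_smul, mul_left_comm,
    mul_inv_cancel₀ (nnnorm_ne_zero_iff.2 ha), mul_one]

theorem weightedNorm_smul (hW : IsNormWeight W) (h0 : φ 0 = 0) (a : 𝕜) (x : Ω →ₘ[μ] 𝕜) :
    weightedNorm φ W (a • x) = ‖a‖ₑ * weightedNorm φ W x := by
  rcases eq_or_ne a 0 with rfl | ha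
  · rw [show (0 : 𝕜) • x = 0 from zero_smul 𝕜 x, weightedNorm_zero hW h0, enorm_zero, zero_mul]
  refine le_antisymm (weightedNorm_smul_le hW.mono ha x) ?_
  have hinv := weightedNorm_smul_le (φ := φ) hW.mono (inv_ne_zero ha) (a • x)
  rw [inv_smul_smul₀ ha, enorm_inv ha, ← ENNReal.div_eq_inv_mul] at hinv
  exact ENNReal.mul_le_of_le_div' hinv

theorem mem_orliczCarrier_iff_luxemburgNorm_lt_top (hφ : IsOrliczFunction φ) (x : Ω →ₘ[μ] 𝕜) :
    x ∈ (orliczCarrier φ : Set (Ω →ₘ[μ] 𝕜)) ↔ luxemburgNorm φ x < ⊤ := by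
  constructor
  · rintro ⟨l, hl, hx⟩
    lift l to ℝ≥0 using hl.le
    calc luxemburgNorm φ x ≤ weightedNorm φ (fun a => 1 + a) x :=
          luxemburgNorm_le_weightedNorm hφ isNormWeight_one_add x
      _ ≤ (l⁻¹ : ℝ≥0) * (1 + modular φ (l⁻¹⁻¹ • x)) :=
          weightedNorm_le φ _ x (inv_pos.2 (NNReal.coe_pos.1 hl))
      _ < ⊤ := by
          rw [inv_inv]
          exact ENNReal.mul_lt_top ENNReal.coe_lt_top
            (ENNReal.add_lt_top.2 ⟨ENNReal.one_lt_top, hx⟩)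
  · intro hx
    obtain ⟨l, hxl, -⟩ := ENNReal.lt_iff_exists_nnreal_btwn.1 hx
    have hl : 0 < l := ENNReal.coe_pos.1 (zero_le.trans_lt hxl)
    exact ⟨(l⁻¹ : ℝ≥0), NNReal.coe_pos.2 (inv_pos.2 hl),
      (modular_le_one_of_luxemburgNorm_lt hφ.mono hxl).trans_lt ENNReal.one_lt_top⟩

theorem mem_orliczCarrier_iff_weightedNorm_lt_top (hφ : IsOrliczFunction φ) (hW : IsNormWeight W)
    (x : Ω →ₘ[μ] 𝕜) : x ∈ (orliczCarrier φ : Set (Ω →ₘ[μ] 𝕜)) ↔ weightedNorm φ W x < ⊤ := by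
  rw [mem_orliczCarrier_iff_luxemburgNorm_lt_top hφ]
  exact ⟨fun h => (weightedNorm_le_mul_luxemburgNorm hW x).trans_lt
    (ENNReal.mul_lt_top hW.map_one_ne_top.lt_top h),
    (luxemburgNorm_le_weightedNorm hφ hW x).trans_lt⟩

theorem IsOrliczFunction.modular_nnreal_smul_eq_zero (hφ : IsOrliczFunction φ) {x : Ω →ₘ[μ] 𝕜}
    (hx : luxemburgNorm φ x = 0) (c : ℝ≥0) : modular φ (c • x) = 0 := by
  have hle_one : ∀ d : ℝ≥0, 0 < d → modular φ (d • x) ≤ 1 := fun d hd => by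
    simpa only [inv_inv] using modular_le_one_of_luxemburgNorm_lt hφ.mono
      (hx.trans_lt (ENNReal.coe_pos.2 (inv_pos.2 hd)))
  refine le_antisymm (ENNReal.le_of_forall_pos_le_add fun ε hε _ => ?_) zero_le
  have hδ : 0 < min ε 1 := lt_min hε one_pos
  calc modular φ (c • x)
      ≤ modular φ ((c + 1) • x) := modular_nnreal_smul_mono hφ.mono x le_self_add
    _ = modular φ (min ε 1 • ((min ε 1)⁻¹ * (c + 1)) • x) := by
        rw [smul_smul, mul_inv_cancel_left₀ hδ.ne']
    _ ≤ (min ε 1 : ℝ≥0) * modular φ (((min ε 1)⁻¹ * (c + 1)) • x) :=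
        hφ.modular_nnreal_smul_le (min_le_right _ _) _
    _ ≤ ε * 1 := by
        gcongr
        exacts [min_le_left _ _, hle_one _ (by positivity)]
    _ = 0 + ε := by rw [mul_one, zero_add]

theorem IsOrliczFunction.eq_zero_of_luxemburgNorm_eq_zero (hφ : IsOrliczFunction φ)
    {x : Ω →ₘ[μ] 𝕜} (hx : luxemburgNorm φ x = 0) : x = 0 := by
  have hzero : ∀ᵐ t ∂μ, ∀ n : ℕ, φ (n * ‖x t‖₊) = 0 := ae_all_iff.2 fun n => by
    have hint := hφ.modular_nnreal_smul_eq_zero hx n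
    rw [modular_nnreal_smul] at hint
    exact (lintegral_eq_zero_iff
      (hφ.mono.measurable.comp (x.measurable.nnnorm.const_mul _))).1 hint
  obtain ⟨v, -, hv⟩ := hφ.exists_le 1
  refine AEEqFun.ext ?_
  filter_upwards [hzero, AEEqFun.coeFn_zero (α := Ω) (β := 𝕜) (μ := μ)] with t ht h0
  rw [h0, Pi.zero_apply]
  by_contra hne
  obtain ⟨n, hn⟩ := exists_nat_ge (v / ‖x t‖₊)
  have hvn : v ≤ n * ‖x t‖₊ := (div_le_iff₀ (nnnorm_pos.2 hne)).1 hn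
  exact one_ne_zero (le_antisymm ((hv.trans (hφ.mono hvn)).trans_eq (ht n)) zero_le)

end Norms

/-! ### Completeness -/

theorem ae_exists_tendsto_of_tsum_measure_ne_top {Ω E : Type*} [MeasurableSpace Ω] {μ : Measure Ω}
    [NormedAddCommGroup E] [CompleteSpace E] {v : ℕ → Ω → E}
    (h : ∑' k, μ {t | (2⁻¹ : ℝ) ^ k ≤ ‖v (k + 1) t - v k t‖} ≠ ⊤) :
    ∀ᵐ t ∂μ, ∃ y, Tendsto (fun k => v k t) atTop (𝓝 y) := by
  filter_upwards [ae_eventually_notMem h] with t ht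
  refine cauchySeq_tendsto_of_complete (cauchySeq_of_summable_dist ?_)
  refine Summable.of_norm_bounded_eventually_nat
    (summable_geometric_of_lt_one (by norm_num) (by norm_num : (2⁻¹ : ℝ) < 1)) ?_
  filter_upwards [ht] with k hk
  rw [Real.norm_of_nonneg dist_nonneg, dist_comm, dist_eq_norm]
  exact (not_le.1 hk).le

theorem IsLeftContinuous.lowerSemicontinuous {φ : ℝ≥0 → ℝ≥0∞} (hl : IsLeftContinuous φ)
    (hm : Monotone φ) : LowerSemicontinuous φ := by
  intro a c hc
  rcases eq_or_ne a 0 with rfl | ha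
  · exact Eventually.of_forall fun b => hc.trans_le (hm zero_le)
  have : (𝓝[<] a).NeBot := nhdsLT_neBot_of_exists_lt ⟨0, pos_iff_ne_zero.2 ha⟩
  obtain ⟨b, hcb, hba⟩ := (((hl a).tendsto.eventually (lt_mem_nhds hc)).and
    self_mem_nhdsWithin).exists
  filter_upwards [lt_mem_nhds hba] with d hd
  exact hcb.trans_le (hm hd.le)

section Completeness

variable {Ω : Type*} [MeasurableSpace Ω] {𝕜 : Type*} [RCLike 𝕜] {μ : Measure Ω}
  {φ : ℝ≥0 → ℝ≥0∞} {W : ℝ≥0∞ → ℝ≥0∞}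

-- Chebyshev's inequality for `φ`, with `v` such that `φ v ≥ N`.
theorem IsOrliczFunction.exists_measure_le_of_luxemburgNorm_lt (hφ : IsOrliczFunction φ) {δ : ℝ≥0}
    (hδ : 0 < δ) (N : ℝ≥0) :
    ∃ ε : ℝ≥0, 0 < ε ∧ ∀ x : Ω →ₘ[μ] 𝕜, luxemburgNorm φ x < ε →
      μ {t | (δ : ℝ) ≤ ‖x t‖} ≤ (N : ℝ≥0∞)⁻¹ := by
  obtain ⟨v, hv, hNv⟩ := hφ.exists_le N
  refine ⟨δ / v, div_pos hδ hv, fun x hx => ?_⟩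
  have hmod := modular_le_one_of_luxemburgNorm_lt hφ.mono hx
  rw [modular_nnreal_smul] at hmod
  have hmeas : Measurable fun t => φ ((δ / v)⁻¹ * ‖x t‖₊) :=
    hφ.mono.measurable.comp (x.measurable.nnnorm.const_mul _)
  rw [ENNReal.le_inv_iff_mul_le, mul_comm]
  refine le_trans ?_ ((mul_meas_ge_le_lintegral hmeas (N : ℝ≥0∞)).trans hmod)
  gcongr with t
  intro ht
  refine hNv.trans (hφ.mono ?_)
  rw [inv_div, div_mul_eq_mul_div, le_div_iff₀ hδ]
  exact mul_le_mul_right (show δ ≤ ‖x t‖₊ from ht) v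

theorem IsOrliczFunction.exists_strictMono_measure_le (hφ : IsOrliczFunction φ)
    {u : ℕ → Ω →ₘ[μ] 𝕜}
    (hu : ∀ ε : ℝ≥0∞, 0 < ε → ∃ n₀, ∀ m ≥ n₀, ∀ n ≥ n₀, luxemburgNorm φ (u m - u n) < ε) :
    ∃ f : ℕ → ℕ, StrictMono f ∧ ∀ k,
      μ {t | (2⁻¹ : ℝ) ^ k ≤ ‖(u (f (k + 1)) - u (f k)) t‖} ≤ (2⁻¹ : ℝ≥0∞) ^ k := by
  have hcheb : ∀ k : ℕ, ∃ ε : ℝ≥0, 0 < ε ∧ ∀ x : Ω →ₘ[μ] 𝕜, luxemburgNorm φ x < ε →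
      μ {t | (((2⁻¹ : ℝ≥0) ^ k : ℝ≥0) : ℝ) ≤ ‖x t‖} ≤ (((2 : ℝ≥0) ^ k : ℝ≥0) : ℝ≥0∞)⁻¹ := fun k =>
    hφ.exists_measure_le_of_luxemburgNorm_lt (by positivity) _
  choose ε hε_pos hε using hcheb
  obtain ⟨f, hf, hfε⟩ := extraction_forall_of_eventually (P := fun k N =>
    ∀ m ≥ N, ∀ n ≥ N, luxemburgNorm φ (u m - u n) < ε k) fun k => by
      obtain ⟨n₀, h⟩ := hu (ε k) (ENNReal.coe_pos.2 (hε_pos k))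
      filter_upwards [eventually_ge_atTop n₀] with N hN m hm n hn
      exact h m (hN.trans hm) n (hN.trans hn)
  refine ⟨f, hf, fun k => ?_⟩
  simpa [ENNReal.inv_pow] using hε k _ (hfε k _ (hf.monotone k.le_succ) _ le_rfl)

theorem IsOrliczFunction.exists_subseq_tendsto_ae (hφ : IsOrliczFunction φ) {u : ℕ → Ω →ₘ[μ] 𝕜}
    (hu : ∀ ε : ℝ≥0∞, 0 < ε → ∃ n₀, ∀ m ≥ n₀, ∀ n ≥ n₀, luxemburgNorm φ (u m - u n) < ε) :
    ∃ f : ℕ → ℕ, StrictMono f ∧ ∃ x : Ω →ₘ[μ] 𝕜,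
      ∀ᵐ t ∂μ, Tendsto (fun k => u (f k) t) atTop (𝓝 (x t)) := by
  obtain ⟨f, hf, hmeas⟩ := hφ.exists_strictMono_measure_le hu
  refine ⟨f, hf, ?_⟩
  have hsum : ∑' k, μ {t | (2⁻¹ : ℝ) ^ k ≤ ‖u (f (k + 1)) t - u (f k) t‖} ≠ ⊤ := by
    refine ne_top_of_le_ne_top ?_
      (ENNReal.tsum_le_tsum fun k => (measure_mono_ae ?_).trans (hmeas k))
    · rw [ENNReal.tsum_geometric, ENNReal.one_sub_inv_two, inv_inv]
      exact ENNReal.ofNat_ne_top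
    · filter_upwards [AEEqFun.coeFn_sub (u (f (k + 1))) (u (f k))] with t ht
      change (2⁻¹ : ℝ) ^ k ≤ _ → (2⁻¹ : ℝ) ^ k ≤ _
      rw [ht]
      exact id
  obtain ⟨g, hg, hlim⟩ := exists_stronglyMeasurable_limit_of_tendsto_ae
    (fun k => (u (f k)).aestronglyMeasurable) (ae_exists_tendsto_of_tsum_measure_ne_top hsum)
  refine ⟨AEEqFun.mk g hg.aestronglyMeasurable, ?_⟩
  filter_upwards [hlim, AEEqFun.coeFn_mk g hg.aestronglyMeasurable] with t ht hgt
  rwa [hgt]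

theorem modular_nnreal_smul_le_of_tendsto_ae (hm : Monotone φ) (hl : IsLeftContinuous φ) (c : ℝ≥0)
    {v : ℕ → Ω →ₘ[μ] 𝕜} {y : Ω →ₘ[μ] 𝕜} (hv : ∀ᵐ t ∂μ, Tendsto (fun k => v k t) atTop (𝓝 (y t)))
    {B : ℝ≥0∞} (hB : ∀ᶠ k in atTop, modular φ (c • v k) ≤ B) : modular φ (c • y) ≤ B := by
  have hlsc := hl.lowerSemicontinuous hm
  simp only [modular_nnreal_smul] at hB ⊢
  calc ∫⁻ t, φ (c * ‖y t‖₊) ∂μ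
      ≤ ∫⁻ t, liminf (fun k => φ (c * ‖v k t‖₊)) atTop ∂μ := by
        refine lintegral_mono_ae (hv.mono fun t ht => ?_)
        have hlim : Tendsto (fun k => c * ‖v k t‖₊) atTop (𝓝 (c * ‖y t‖₊)) := ht.nnnorm.const_mul c
        exact (hlsc.le_liminf _).trans hlim.liminf_le_liminf_comp
    _ ≤ liminf (fun k => ∫⁻ t, φ (c * ‖v k t‖₊) ∂μ) atTop :=
        lintegral_liminf_le fun k => hm.measurable.comp ((v k).measurable.nnnorm.const_mul c)
    _ ≤ B := liminf_le_of_frequently_le' hB.frequently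

theorem IsOrliczFunction.exists_tendsto_luxemburgNorm (hφ : IsOrliczFunction φ)
    (hl : IsLeftContinuous φ) {u : ℕ → Ω →ₘ[μ] 𝕜}
    (hu : ∀ ε : ℝ≥0∞, 0 < ε → ∃ n₀, ∀ m ≥ n₀, ∀ n ≥ n₀, luxemburgNorm φ (u m - u n) < ε) :
    ∃ x : Ω →ₘ[μ] 𝕜, Tendsto (fun n => luxemburgNorm φ (u n - x)) atTop (𝓝 0) := by
  obtain ⟨f, hf, x, hx⟩ := hφ.exists_subseq_tendsto_ae hu
  refine ⟨x, ENNReal.tendsto_atTop_zero.2 fun ε hε => ?_⟩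
  obtain ⟨e, he, heε⟩ := ENNReal.lt_iff_exists_nnreal_btwn.1 hε
  obtain ⟨n₀, hn₀⟩ := hu e he
  refine ⟨n₀, fun n hn => (luxemburgNorm_le (ENNReal.coe_pos.1 he) ?_).trans heε.le⟩
  refine modular_nnreal_smul_le_of_tendsto_ae hφ.mono hl _ (v := fun k => u n - u (f k)) ?_ ?_
  · have hsub : ∀ᵐ t ∂μ, ∀ k, (u n - u (f k)) t = u n t - u (f k) t :=
      ae_all_iff.2 fun k => AEEqFun.coeFn_sub _ _
    filter_upwards [hx, hsub, AEEqFun.coeFn_sub (u n) x] with t hlim hsubt hsubx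
    simp only [hsubx, hsubt]
    exact tendsto_const_nhds.sub hlim
  · filter_upwards [hf.tendsto_atTop.eventually_ge_atTop n₀] with k hk
    exact modular_le_one_of_luxemburgNorm_lt hφ.mono (hn₀ n hn _ hk)

theorem IsOrliczFunction.exists_tendsto_weightedNorm (hφ : IsOrliczFunction φ)
    (hl : IsLeftContinuous φ) (hW : IsNormWeight W) {u : ℕ → Ω →ₘ[μ] 𝕜}
    (hu : ∀ ε : ℝ≥0∞, 0 < ε → ∃ n₀, ∀ m ≥ n₀, ∀ n ≥ n₀, weightedNorm φ W (u m - u n) < ε) :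
    ∃ x : Ω →ₘ[μ] 𝕜, Tendsto (fun n => weightedNorm φ W (u n - x)) atTop (𝓝 0) := by
  obtain ⟨x, hx⟩ := hφ.exists_tendsto_luxemburgNorm hl (u := u) fun ε hε => by
    obtain ⟨n₀, h⟩ := hu ε hε
    exact ⟨n₀, fun m hm n hn => (luxemburgNorm_le_weightedNorm hφ hW _).trans_lt (h m hm n hn)⟩
  have hbound := ENNReal.Tendsto.const_mul hx (Or.inr hW.map_one_ne_top)
  rw [mul_zero] at hbound
  exact ⟨x, tendsto_of_tendsto_of_tendsto_of_le_of_le tendsto_const_nhds hbound (fun _ => zero_le)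
    fun n => weightedNorm_le_mul_luxemburgNorm hW _⟩

/-- The Orlicz space `L^φ` with the norm defined by the weight `W`. -/
noncomputable def orliczSpace (𝕜 : Type*) [RCLike 𝕜] (μ : Measure Ω) (φ : ℝ≥0 → ℝ≥0∞)
    (W : ℝ≥0∞ → ℝ≥0∞) : FnSpace 𝕜 μ where
  carrier := orliczCarrier φ
  nrm := weightedNorm φ W

theorem orliczLuxemburg_eq_orliczSpace (φ : ℝ≥0 → ℝ≥0∞) :
    FnSpace.orliczLuxemburg 𝕜 μ φ = orliczSpace 𝕜 μ φ luxemburgWeight :=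
  congrArg (FnSpace.mk _) (funext (luxemburgNorm_eq_weightedNorm φ))

theorem orliczAmemiya_eq_orliczSpace (φ : ℝ≥0 → ℝ≥0∞) :
    FnSpace.orliczAmemiya 𝕜 μ φ = orliczSpace 𝕜 μ φ fun a => 1 + a :=
  congrArg (FnSpace.mk _) (funext (orliczNorm_eq_weightedNorm φ))

theorem mem_orliczSpace_iff (hφ : IsOrliczFunction φ) (hW : IsNormWeight W) (x : Ω →ₘ[μ] 𝕜) :
    x ∈ (orliczSpace 𝕜 μ φ W).carrier ↔ weightedNorm φ W x < ⊤ :=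
  mem_orliczCarrier_iff_weightedNorm_lt_top hφ hW x

theorem IsOrliczFunction.isBanach_orliczSpace (hφ : IsOrliczFunction φ) (hl : IsLeftContinuous φ)
    (hW : IsNormWeight W) : (orliczSpace 𝕜 μ φ W).IsBanach := by
  have mem := mem_orliczSpace_iff (𝕜 := 𝕜) (μ := μ) hφ hW
  have add_mem : ∀ x ∈ (orliczSpace 𝕜 μ φ W).carrier, ∀ y ∈ (orliczSpace 𝕜 μ φ W).carrier,
      x + y ∈ (orliczSpace 𝕜 μ φ W).carrier := fun x hx y hy => (mem _).2 <|
    (weightedNorm_add_le hφ hW x y).trans_lt (ENNReal.add_lt_top.2 ⟨(mem x).1 hx, (mem y).1 hy⟩)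
  have smul_mem : ∀ c : 𝕜, ∀ x ∈ (orliczSpace 𝕜 μ φ W).carrier,
      c • x ∈ (orliczSpace 𝕜 μ φ W).carrier := fun c x hx => (mem _).2 <| by
    rw [weightedNorm_smul hW hφ.map_zero]
    exact ENNReal.mul_lt_top enorm_lt_top ((mem x).1 hx)
  refine ⟨?_, add_mem, smul_mem, fun x hx => (mem x).1 hx, fun x _ => ⟨fun hx => ?_, ?_⟩,
    fun x _ y _ => weightedNorm_add_le hφ hW x y,
    fun c x _ => weightedNorm_smul hW hφ.map_zero c x, fun u hu hcauchy => ?_⟩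
  · exact (mem 0).2 ((weightedNorm_zero hW hφ.map_zero).trans_lt ENNReal.zero_lt_top)
  · exact hφ.eq_zero_of_luxemburgNorm_eq_zero
      (le_antisymm ((luxemburgNorm_le_weightedNorm hφ hW x).trans_eq hx) zero_le)
  · rintro rfl
    exact weightedNorm_zero hW hφ.map_zero
  · obtain ⟨x, hx⟩ := hφ.exists_tendsto_weightedNorm hl hW hcauchy
    obtain ⟨n, hn⟩ := (hx.eventually (gt_mem_nhds ENNReal.zero_lt_top)).exists
    have hlimit : u n + (-1 : 𝕜) • (u n - x) = x := by
      rw [show (-1 : 𝕜) • (u n - x) = -(u n - x) from neg_one_smul 𝕜 (u n - x)]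
      abel
    exact ⟨x, hlimit ▸ add_mem _ (hu n) _ (smul_mem (-1) _ ((mem _).2 hn)), hx⟩

end Completeness

/-! ### The Orlicz function of a concave function -/

theorem chord_le_of_concaveOn {h : ℝ≥0 → ℝ≥0} (hh : ConcaveOn ℝ≥0 univ h) {a b c : ℝ≥0}
    (hab : a ≤ b) (hbc : b ≤ c) :
    ((c : ℝ) - b) * h a + ((b : ℝ) - a) * h c ≤ ((c : ℝ) - a) * h b := by
  rcases hab.eq_or_lt with rfl | hab'
  · simp
  have hac : a < c := hab'.trans_le hbc
  have hca : (0 : ℝ) < c - a := sub_pos.2 (NNReal.coe_lt_coe.2 hac)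
  have hα : (((c - b) / (c - a) : ℝ≥0) : ℝ) = (c - b) / (c - a) := by
    rw [NNReal.coe_div, NNReal.coe_sub hbc, NNReal.coe_sub hac.le]
  have hβ : (((b - a) / (c - a) : ℝ≥0) : ℝ) = (b - a) / (c - a) := by
    rw [NNReal.coe_div, NNReal.coe_sub hab, NNReal.coe_sub hac.le]
  have hsum : (c - b) / (c - a) + (b - a) / (c - a) = 1 := by
    rw [← add_div, tsub_add_tsub_cancel hbc hab, div_self (tsub_pos_of_lt hac).ne']
  have hpoint : ((c - b) / (c - a)) • a + ((b - a) / (c - a)) • c = b := by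
    rw [← NNReal.coe_inj]
    simp only [smul_eq_mul, NNReal.coe_add, NNReal.coe_mul, hα, hβ]
    field_simp
    ring
  have hconc := hh.2 (mem_univ a) (mem_univ c) zero_le zero_le hsum
  rw [hpoint, ← NNReal.coe_le_coe] at hconc
  simp only [smul_eq_mul, NNReal.coe_add, NNReal.coe_mul, hα, hβ] at hconc
  calc ((c : ℝ) - b) * h a + ((b : ℝ) - a) * h c
      = (c - a) * ((c - b) / (c - a) * h a + (b - a) / (c - a) * h c) := by field_simp
    _ ≤ (c - a) * h b := by gcongr

theorem monotone_of_concaveOn {h : ℝ≥0 → ℝ≥0} (hh : ConcaveOn ℝ≥0 univ h) : Monotone h := by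
  intro a b hab
  by_contra! hlt
  obtain ⟨n, hn⟩ := exists_lt_nsmul (sub_pos.2 (NNReal.coe_lt_coe.2 hlt)) ((b : ℝ) * h b)
  have hchord := chord_le_of_concaveOn hh hab (le_self_add : b ≤ b + n)
  rw [nsmul_eq_mul] at hn
  push_cast at hchord
  have ha : 0 ≤ (a : ℝ) * h b := by positivity
  have hb : 0 ≤ ((b : ℝ) - a) * h (b + n) :=
    mul_nonneg (sub_nonneg.2 (NNReal.coe_le_coe.2 hab)) (NNReal.coe_nonneg _)
  linarith

theorem mul_le_mul_of_concaveOn {h : ℝ≥0 → ℝ≥0} (hh : ConcaveOn ℝ≥0 univ h) {a b : ℝ≥0}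
    (hab : a ≤ b) : a * h b ≤ b * h a := by
  have hchord := chord_le_of_concaveOn hh zero_le hab
  simp only [NNReal.coe_zero, sub_zero] at hchord
  have hnonneg : 0 ≤ ((b : ℝ) - a) * h 0 :=
    mul_nonneg (sub_nonneg.2 (NNReal.coe_le_coe.2 hab)) (h 0).coe_nonneg
  rw [← NNReal.coe_le_coe]
  push_cast
  linarith

-- The line through the points of the graph over `a` and `b`.
theorem exists_affine_of_concaveOn_of_lt {h : ℝ≥0 → ℝ≥0} (hh : ConcaveOn ℝ≥0 univ h)
    {a b : ℝ≥0} (hab : a < b) :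
    ∃ k d : ℝ≥0, h b = k * b + d ∧ h a = k * a + d ∧ ∀ c, b ≤ c → h c ≤ k * c + d := by
  have hba : (0 : ℝ) < b - a := sub_pos.2 (NNReal.coe_lt_coe.2 hab)
  have hmono : (h a : ℝ) ≤ h b := NNReal.coe_le_coe.2 (monotone_of_concaveOn hh hab.le)
  have hstar : (a : ℝ) * h b ≤ b * h a := NNReal.coe_le_coe.2 (mul_le_mul_of_concaveOn hh hab.le)
  obtain ⟨k, hk⟩ : ∃ k : ℝ≥0, (k : ℝ) = (h b - h a) / (b - a) :=
    ⟨⟨_, div_nonneg (sub_nonneg.2 hmono) hba.le⟩, rfl⟩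
  obtain ⟨d, hd⟩ : ∃ d : ℝ≥0, (d : ℝ) = (b * h a - a * h b) / (b - a) :=
    ⟨⟨_, div_nonneg (sub_nonneg.2 hstar) hba.le⟩, rfl⟩
  refine ⟨k, d, ?_, ?_, fun c hbc => ?_⟩
  · rw [← NNReal.coe_inj, NNReal.coe_add, NNReal.coe_mul, hk, hd]
    field_simp
    ring
  · rw [← NNReal.coe_inj, NNReal.coe_add, NNReal.coe_mul, hk, hd]
    field_simp
    ring
  · have hchord := chord_le_of_concaveOn hh hab.le hbc
    rw [← NNReal.coe_le_coe, NNReal.coe_add, NNReal.coe_mul, hk, hd, div_mul_eq_mul_div, ← add_div,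
      le_div_iff₀ hba]
    linarith

theorem exists_affine_ge_of_concaveOn {h : ℝ≥0 → ℝ≥0} (hh : ConcaveOn ℝ≥0 univ h)
    {a b c : ℝ≥0} (hb : 0 < b) (hab : a ≤ b) (hbc : b ≤ c) :
    ∃ k d : ℝ≥0, h b = k * b + d ∧ h a ≤ k * a + d ∧ h c ≤ k * c + d := by
  rcases hab.eq_or_lt with rfl | hab'
  · obtain ⟨k, d, hkb, -, hkc⟩ := exists_affine_of_concaveOn_of_lt hh hb
    exact ⟨k, d, hkb, hkb.le, hkc c hbc⟩
  · obtain ⟨k, d, hkb, hka, hkc⟩ := exists_affine_of_concaveOn_of_lt hh hab'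
    exact ⟨k, d, hkb, hka.le, hkc c hbc⟩

section PowerMean

variable {p : ℝ}

-- Minkowski's inequality in `ℓ^p` with the weights `α, β`, for `k (v, w)` and `d (1, 1)`.
theorem affine_rpow_mean_le (hp : 1 ≤ p) (k d : ℝ≥0) {α β : ℝ≥0} (hαβ : α + β = 1) (v w : ℝ≥0) :
    α * (k * v + d) ^ p + β * (k * w + d) ^ p ≤
      (k * (α * v ^ p + β * w ^ p) ^ (1 / p) + d) ^ p := by
  have hp0 : p ≠ 0 := (zero_lt_one.trans_le hp).ne'
  have hmink := NNReal.Lp_add_le Finset.univ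
    ![α ^ (1 / p) * (k * v), β ^ (1 / p) * (k * w)] ![α ^ (1 / p) * d, β ^ (1 / p) * d] hp
  simp only [Fin.sum_univ_two, Matrix.cons_val_zero, Matrix.cons_val_one, ← mul_add,
    NNReal.mul_rpow, rpow_one_div_rpow hp0] at hmink
  have hlinear : (α * (k ^ p * v ^ p) + β * (k ^ p * w ^ p)) ^ (1 / p) =
      k * (α * v ^ p + β * w ^ p) ^ (1 / p) := by
    rw [mul_left_comm α, mul_left_comm β, ← mul_add, NNReal.mul_rpow, rpow_rpow_one_div hp0]
  have hconst : (α * d ^ p + β * d ^ p) ^ (1 / p) = d := by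
    rw [← add_mul, hαβ, one_mul, rpow_rpow_one_div hp0]
  rw [hlinear, hconst] at hmink
  simpa only [rpow_one_div_rpow hp0] using NNReal.rpow_le_rpow hmink (zero_le_one.trans hp)

theorem rpow_mean_le_of_concaveOn_of_le {h : ℝ≥0 → ℝ≥0} (hh : ConcaveOn ℝ≥0 univ h)
    (hp : 1 ≤ p) {α β : ℝ≥0} (hαβ : α + β = 1) {v w : ℝ≥0}
    (hvw : v ≤ w) :
    α * h v ^ p + β * h w ^ p ≤ h ((α * v ^ p + β * w ^ p) ^ (1 / p)) ^ p := by
  have hp0 : 0 < p := zero_lt_one.trans_le hp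
  set b := (α * v ^ p + β * w ^ p) ^ (1 / p)
  have hbp : b ^ p = α * v ^ p + β * w ^ p := rpow_one_div_rpow hp0.ne' _
  have hmean : ∀ a : ℝ≥0, α * a ^ p + β * a ^ p = a ^ p := fun a => by
    rw [← add_mul, hαβ, one_mul]
  have hvb : v ≤ b := by
    refine (NNReal.rpow_le_rpow_iff hp0).1 ((hmean v).symm.trans_le ?_)
    rw [hbp]
    gcongr
  have hbw : b ≤ w := by
    refine (NNReal.rpow_le_rpow_iff hp0).1 (le_trans ?_ (hmean w).le)
    rw [hbp]
    gcongr
  rcases eq_or_ne b 0 with hb0 | hb0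
  · obtain rfl : v = 0 := le_antisymm (hvb.trans_eq hb0) zero_le
    refine le_trans (le_of_eq ?_) (hmean (h b)).le
    rw [hb0, NNReal.zero_rpow hp0.ne', mul_zero, zero_add, eq_comm, mul_eq_zero,
      NNReal.rpow_eq_zero hp0.ne'] at hbp
    rcases hbp with hβ | hw
    · rw [hb0, hβ, zero_mul, zero_mul]
    · rw [hb0, hw]
  obtain ⟨k, d, hkb, hkv, hkw⟩ :=
    exists_affine_ge_of_concaveOn hh (pos_iff_ne_zero.2 hb0) hvb hbw
  calc α * h v ^ p + β * h w ^ p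
      ≤ α * (k * v + d) ^ p + β * (k * w + d) ^ p := by gcongr
    _ ≤ (k * b + d) ^ p := affine_rpow_mean_le hp k d hαβ v w
    _ = h b ^ p := by rw [hkb]

theorem rpow_mean_le_of_concaveOn {h : ℝ≥0 → ℝ≥0} (hh : ConcaveOn ℝ≥0 univ h)
    (hp : 1 ≤ p) {α β : ℝ≥0} (hαβ : α + β = 1) (v w : ℝ≥0) :
    α * h v ^ p + β * h w ^ p ≤ h ((α * v ^ p + β * w ^ p) ^ (1 / p)) ^ p := by
  rcases le_total v w with hvw | hwv
  · exact rpow_mean_le_of_concaveOn_of_le hh hp hαβ hvw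
  · rw [add_comm (α * h v ^ p), add_comm (α * v ^ p)]
    exact rpow_mean_le_of_concaveOn_of_le hh hp ((add_comm β α).trans hαβ) hwv

end PowerMean

section RhoStar

variable {ρ : ℝ≥0 → ℝ≥0}

theorem rhoStar_zero (ρ : ℝ≥0 → ℝ≥0) : rhoStar ρ 0 = 0 := zero_mul _

theorem monotone_rhoStar (hρ : ConcaveOn ℝ≥0 univ ρ) : Monotone (rhoStar ρ) := by
  intro a b hab
  rcases eq_or_ne a 0 with rfl | ha
  · rw [rhoStar_zero]
    exact zero_le
  have ha' : 0 < a := pos_iff_ne_zero.2 ha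
  have hb' : 0 < b := ha'.trans_le hab
  have hinv := mul_le_mul_of_concaveOn hρ (one_div_le_one_div_of_le ha' hab)
  calc a * ρ (1 / a) = a * b * (1 / b * ρ (1 / a)) := by field_simp
    _ ≤ a * b * (1 / a * ρ (1 / b)) := by gcongr
    _ = b * ρ (1 / b) := by field_simp

-- Concavity of `ρ` at `1 / a` and `1 / b`, with weights proportional to `α a` and `β b`.
theorem concaveOn_rhoStar (hρ : ConcaveOn ℝ≥0 univ ρ) : ConcaveOn ℝ≥0 univ (rhoStar ρ) := by
  refine ⟨convex_univ, fun a _ b _ α β _ _ hαβ => ?_⟩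
  simp only [rhoStar, smul_eq_mul]
  set m := α * a + β * b with hm
  rcases eq_or_ne m 0 with hm0 | hm0
  · obtain ⟨hα, hβ⟩ := add_eq_zero.1 hm0
    rw [← mul_assoc, ← mul_assoc, hα, hβ, zero_mul, zero_mul, add_zero]
    exact zero_le
  have hweights : α * a / m + β * b / m = 1 := by rw [← add_div, ← hm, div_self hm0]
  have hpoint : α * a / m * (1 / a) + β * b / m * (1 / b) ≤ 1 / m := by
    calc α * a / m * (1 / a) + β * b / m * (1 / b)
        = (α * (a * (1 / a)) + β * (b * (1 / b))) / m := by ring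
      _ ≤ (α * 1 + β * 1) / m := by
        gcongr <;> exact (mul_one_div _ _).trans_le (div_self_le_one _)
      _ = 1 / m := by rw [mul_one, mul_one, hαβ]
  have hconc := hρ.2 (mem_univ (1 / a)) (mem_univ (1 / b)) zero_le zero_le hweights
  simp only [smul_eq_mul] at hconc
  calc α * (a * ρ (1 / a)) + β * (b * ρ (1 / b))
      = m * (α * a / m * ρ (1 / a) + β * b / m * ρ (1 / b)) := by field_simp
    _ ≤ m * ρ (1 / m) := by
      gcongr
      exact hconc.trans (monotone_of_concaveOn hρ hpoint)

theorem surjective_rhoStar (h : rhoStar ρ '' Ioi 0 = Ioi 0) : Function.Surjective (rhoStar ρ) := by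
  intro v
  rcases eq_or_ne v 0 with rfl | hv
  · exact ⟨0, rhoStar_zero ρ⟩
  · obtain ⟨w, -, hw⟩ := h.ge (pos_iff_ne_zero.2 hv : v ∈ Ioi 0)
    exact ⟨w, hw⟩

variable {p : ℝ} {φ : ℝ≥0 → ℝ≥0∞}

-- The substitution `u = w ^ p`, under which `u ^ (1 / p) * ρ (u ^ (-(1 / p)))` is `ρ_* w`.
theorem map_rhoStar_eq_rpow (hp : p ≠ 0) (h0 : φ 0 = 0)
    (h : ∀ u : ℝ≥0, 0 < u → φ (u ^ (1 / p) * ρ (u ^ (-(1 / p)))) = u) (w : ℝ≥0) :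
    φ (rhoStar ρ w) = ((w ^ p : ℝ≥0) : ℝ≥0∞) := by
  rcases eq_or_ne w 0 with rfl | hw
  · rw [rhoStar_zero, h0, NNReal.zero_rpow hp, ENNReal.coe_zero]
  · have hwp := h (w ^ p) (NNReal.rpow_pos (pos_iff_ne_zero.2 hw))
    rwa [NNReal.rpow_neg, rpow_rpow_one_div hp, ← one_div] at hwp

theorem strictMono_rhoStar (hρ : ConcaveOn ℝ≥0 univ ρ) (hp : p ≠ 0)
    (h : ∀ w, φ (rhoStar ρ w) = ((w ^ p : ℝ≥0) : ℝ≥0∞)) : StrictMono (rhoStar ρ) := by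
  refine (monotone_rhoStar hρ).strictMono_of_injective fun a b hab => ?_
  have hpow := h a
  rw [hab, h b, ENNReal.coe_inj] at hpow
  exact (NNReal.rpow_left_injective hp hpow).symm

theorem monotone_of_map_rhoStar (hp : 0 ≤ p) (hs : StrictMono (rhoStar ρ))
    (hsurj : Function.Surjective (rhoStar ρ))
    (h : ∀ w, φ (rhoStar ρ w) = ((w ^ p : ℝ≥0) : ℝ≥0∞)) : Monotone φ := by
  intro u v huv
  obtain ⟨a, rfl⟩ := hsurj u
  obtain ⟨b, rfl⟩ := hsurj v
  rw [h, h, ENNReal.coe_le_coe]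
  exact NNReal.rpow_le_rpow (hs.le_iff_le.1 huv) hp

theorem continuous_of_map_rhoStar (hp : 0 ≤ p) (hs : StrictMono (rhoStar ρ))
    (hsurj : Function.Surjective (rhoStar ρ))
    (h : ∀ w, φ (rhoStar ρ w) = ((w ^ p : ℝ≥0) : ℝ≥0∞)) : Continuous φ := by
  let R := hs.orderIsoOfSurjective (rhoStar ρ) hsurj
  have hφ : φ = fun v => ((R.symm v ^ p : ℝ≥0) : ℝ≥0∞) := by
    ext1 v
    rw [← h]
    exact congrArg φ (R.apply_symm_apply v).symm
  rw [hφ]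
  exact ENNReal.continuous_coe.comp
    ((NNReal.continuous_rpow_const hp).comp R.symm.continuous)

theorem convexOn_rpow_of_map_rhoStar (hρ : ConcaveOn ℝ≥0 univ ρ) (hp : 1 ≤ p)
    (hm : Monotone φ) (hsurj : Function.Surjective (rhoStar ρ))
    (h : ∀ w, φ (rhoStar ρ w) = ((w ^ p : ℝ≥0) : ℝ≥0∞)) :
    ConvexOn ℝ≥0 univ (fun u : ℝ≥0 => φ (u ^ (1 / p))) := by
  have hp0 : 0 < p := zero_lt_one.trans_le hp
  refine ⟨convex_univ, fun u _ v _ α β _ _ hαβ => ?_⟩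
  obtain ⟨a, ha⟩ := hsurj (u ^ (1 / p))
  obtain ⟨b, hb⟩ := hsurj (v ^ (1 / p))
  have hmean := rpow_mean_le_of_concaveOn (concaveOn_rhoStar hρ) hp hαβ a b
  rw [ha, hb, rpow_one_div_rpow hp0.ne', rpow_one_div_rpow hp0.ne'] at hmean
  calc φ ((α * u + β * v) ^ (1 / p))
      ≤ φ (rhoStar ρ ((α * a ^ p + β * b ^ p) ^ (1 / p))) := by
        refine hm ((NNReal.rpow_le_rpow_iff hp0).1 ?_)
        rwa [rpow_one_div_rpow hp0.ne']
    _ = α • φ (rhoStar ρ a) + β • φ (rhoStar ρ b) := by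
        rw [h, h, h, rpow_one_div_rpow hp0.ne']
        push_cast
        rfl
    _ = α • φ (u ^ (1 / p)) + β • φ (v ^ (1 / p)) := by rw [ha, hb]

theorem convexOn_of_convexOn_rpow (hp : 1 ≤ p) (hm : Monotone φ)
    (hc : ConvexOn ℝ≥0 univ (fun u : ℝ≥0 => φ (u ^ (1 / p)))) : ConvexOn ℝ≥0 univ φ := by
  have hp0 : p ≠ 0 := (zero_lt_one.trans_le hp).ne'
  refine ⟨convex_univ, fun u _ v _ α β hα hβ hαβ => ?_⟩
  have hconv := hc.2 (mem_univ (u ^ p)) (mem_univ (v ^ p)) hα hβ hαβ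
  simp only [rpow_rpow_one_div hp0] at hconv
  refine le_trans (hm ?_) hconv
  rw [← rpow_rpow_one_div hp0 (α • u + β • v)]
  gcongr
  exact NNReal.rpow_arith_mean_le_arith_mean2_rpow α β u v hαβ hp

theorem isOrliczFunction_of_map_rhoStar (hρ : ConcaveOn ℝ≥0 univ ρ) (hp : 1 ≤ p)
    (hs : StrictMono (rhoStar ρ)) (hsurj : Function.Surjective (rhoStar ρ))
    (h : ∀ w, φ (rhoStar ρ w) = ((w ^ p : ℝ≥0) : ℝ≥0∞)) : IsOrliczFunction φ := by
  have hp0 : 0 < p := zero_lt_one.trans_le hp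
  have hm := monotone_of_map_rhoStar hp0.le hs hsurj h
  have h0 : φ 0 = 0 := by
    rw [← rhoStar_zero ρ, h, NNReal.zero_rpow hp0.ne', ENNReal.coe_zero]
  have hlim := (continuous_of_map_rhoStar hp0.le hs hsurj h).tendsto 0
  rw [h0] at hlim
  have hpos : 0 < rhoStar ρ 1 := (rhoStar_zero ρ).symm.trans_lt (hs zero_lt_one)
  have hone : φ (rhoStar ρ 1) = 1 := by rw [h, NNReal.one_rpow, ENNReal.coe_one]
  exact ⟨hm, convexOn_of_convexOn_rpow hp hm (convexOn_rpow_of_map_rhoStar hρ hp hm hsurj h), h0,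
    hlim.mono_left nhdsWithin_le_nhds, ⟨_, hpos, hone ▸ one_ne_zero⟩,
    ⟨_, hpos, hone ▸ ENNReal.one_ne_top⟩⟩

end RhoStar

/-! ### Embeddings and interpolation -/

section Interpolation

variable {Ω : Type*} [MeasurableSpace Ω] {𝕜 : Type*} [RCLike 𝕜] {μ : Measure Ω}
  {φ : ℝ≥0 → ℝ≥0∞} {W : ℝ≥0∞ → ℝ≥0∞} {p : ℝ≥0} {x : Ω →ₘ[μ] 𝕜} {l v w : ℝ≥0}

theorem map_mul_le_rpow_mul (hp : p ≠ 0) (h0 : φ 0 = 0)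
    (hc : ConvexOn ℝ≥0 univ (fun u : ℝ≥0 => φ (u ^ (1 / (p : ℝ))))) {a : ℝ≥0} (ha : a ≤ 1)
    (v : ℝ≥0) : φ (a * v) ≤ (a ^ (p : ℝ) : ℝ≥0) * φ v := by
  have hp0 : (p : ℝ) ≠ 0 := NNReal.coe_ne_zero.2 hp
  have hscale := map_nnreal_smul_le_of_convexOn hc
    (by rw [NNReal.zero_rpow (one_div_ne_zero hp0), h0]) (NNReal.rpow_le_one ha p.coe_nonneg)
    (v ^ (p : ℝ))
  simpa only [smul_eq_mul, ← NNReal.mul_rpow, rpow_rpow_one_div hp0] using hscale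

theorem modular_smul_le_of_eLpNorm_le (hp : p ≠ 0) (h0 : φ 0 = 0)
    (hc : ConvexOn ℝ≥0 univ (fun u : ℝ≥0 => φ (u ^ (1 / (p : ℝ))))) (hl : 0 < l)
    (hxp : eLpNorm x p μ ≤ l) (hxtop : eLpNorm x ⊤ μ ≤ l) (w : ℝ≥0) :
    modular φ ((w / l) • x) ≤ φ w := by
  have hbdd : ∀ᵐ t ∂μ, ‖x t‖₊ / l ≤ 1 := by
    rw [eLpNorm_exponent_top] at hxtop
    filter_upwards [enorm_ae_le_eLpNormEssSup x μ] with t ht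
    exact (div_le_one hl).2 (ENNReal.coe_le_coe.1 (ht.trans hxtop))
  have hpow : ∀ t, (((‖x t‖₊ / l) ^ (p : ℝ) : ℝ≥0) : ℝ≥0∞) =
      (l : ℝ≥0∞)⁻¹ ^ (p : ℝ) * ‖x t‖ₑ ^ (p : ℝ) := fun t => by
    rw [ENNReal.coe_rpow_of_nonneg _ p.coe_nonneg, ENNReal.coe_div hl.ne', ENNReal.div_eq_inv_mul,
      ENNReal.mul_rpow_of_nonneg _ _ p.coe_nonneg, enorm_eq_nnnorm]
  rw [modular_nnreal_smul]
  calc ∫⁻ t, φ (w / l * ‖x t‖₊) ∂μ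
      ≤ ∫⁻ t, ((‖x t‖₊ / l) ^ (p : ℝ) : ℝ≥0) * φ w ∂μ := by
        refine lintegral_mono_ae (hbdd.mono fun t ht => ?_)
        rw [div_mul_eq_mul_div, mul_comm, mul_div_right_comm]
        exact map_mul_le_rpow_mul hp h0 hc ht w
    _ = ((l : ℝ≥0∞)⁻¹ * eLpNorm x p μ) ^ (p : ℝ) * φ w := by
        rw [lintegral_mul_const _ (by fun_prop), ENNReal.mul_rpow_of_nonneg _ _ p.coe_nonneg,
          eLpNorm_nnreal_pow_eq_lintegral hp, ← lintegral_const_mul' _ _ (by finiteness)]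
        simp only [hpow]
    _ ≤ 1 * φ w := by
        gcongr
        refine ENNReal.rpow_le_one ?_ p.coe_nonneg
        rw [← ENNReal.div_eq_inv_mul]
        exact ENNReal.div_le_of_le_mul (by rwa [one_mul])
    _ = φ w := one_mul _

theorem luxemburgNorm_le_mul_interNrm (hp : p ≠ 0) (h0 : φ 0 = 0)
    (hc : ConvexOn ℝ≥0 univ (fun u : ℝ≥0 => φ (u ^ (1 / (p : ℝ))))) (hw : 0 < w) (hφw : φ w ≤ 1)
    (x : Ω →ₘ[μ] 𝕜) :
    luxemburgNorm φ x ≤ ((w⁻¹ : ℝ≥0) : ℝ≥0∞) *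
      FnSpace.interNrm (FnSpace.lebesgue 𝕜 μ p) (FnSpace.lebesgue 𝕜 μ ⊤) x := by
  rw [ENNReal.coe_inv hw.ne', ← ENNReal.div_eq_inv_mul, ENNReal.le_div_iff_mul_le
    (.inl (ENNReal.coe_ne_zero.2 hw.ne')) (.inl ENNReal.coe_ne_top)]
  refine le_of_forall_gt_imp_ge_of_dense fun a ha => ?_
  obtain ⟨l, hxl, hla⟩ := ENNReal.lt_iff_exists_nnreal_btwn.1 ha
  have hl : 0 < l := ENNReal.coe_pos.1 (zero_le.trans_lt hxl)
  have hmod := modular_smul_le_of_eLpNorm_le hp h0 hc hl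
    ((le_max_left _ _).trans hxl.le) ((le_max_right _ _).trans hxl.le) w
  rw [← inv_div] at hmod
  calc luxemburgNorm φ x * w ≤ (l / w : ℝ≥0) * w := by
        gcongr
        exact luxemburgNorm_le (div_pos hl hw) (hmod.trans hφw)
    _ = l := by rw [← ENNReal.coe_mul, div_mul_cancel₀ _ hw.ne']
    _ ≤ a := hla.le

theorem rpow_tsub_mul_rpow_le (hp : p ≠ 0) (h0 : φ 0 = 0)
    (hc : ConvexOn ℝ≥0 univ (fun u : ℝ≥0 => φ (u ^ (1 / (p : ℝ))))) (hv : 1 ≤ φ v) (hl : 0 < l)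
    (a : ℝ≥0) : ((a ^ (p : ℝ) : ℝ≥0) : ℝ≥0∞) - ((l * v) ^ (p : ℝ) : ℝ≥0) ≤
      ((l * v) ^ (p : ℝ) : ℝ≥0) * φ (l⁻¹ * a) := by
  rcases le_or_gt a (l * v) with hav | hva
  · rw [tsub_eq_zero_of_le (ENNReal.coe_le_coe.2 (NNReal.rpow_le_rpow hav p.coe_nonneg))]
    exact zero_le
  have ha : a ≠ 0 := (zero_le.trans_lt hva).ne'
  have hφv : φ v ≤ ((l * v / a) ^ (p : ℝ) : ℝ≥0) * φ (l⁻¹ * a) := by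
    refine le_of_eq_of_le (congrArg φ ?_)
      (map_mul_le_rpow_mul hp h0 hc (div_le_one_of_le₀ hva.le zero_le) (l⁻¹ * a))
    field_simp
  calc ((a ^ (p : ℝ) : ℝ≥0) : ℝ≥0∞) - ((l * v) ^ (p : ℝ) : ℝ≥0)
      ≤ (a ^ (p : ℝ) : ℝ≥0) * φ v := tsub_le_self.trans (le_mul_of_one_le_right' hv)
    _ ≤ (a ^ (p : ℝ) : ℝ≥0) * (((l * v / a) ^ (p : ℝ) : ℝ≥0) * φ (l⁻¹ * a)) := by gcongr
    _ = ((l * v) ^ (p : ℝ) : ℝ≥0) * φ (l⁻¹ * a) := by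
        rw [← mul_assoc, ← ENNReal.coe_mul, ← NNReal.mul_rpow, mul_div_cancel₀ _ ha]

theorem eLpNorm_sub_radialTrunc_le (hp : 1 ≤ p) (h0 : φ 0 = 0)
    (hc : ConvexOn ℝ≥0 univ (fun u : ℝ≥0 => φ (u ^ (1 / (p : ℝ))))) (hv : 1 ≤ φ v) (hl : 0 < l)
    (hx : modular φ (l⁻¹ • x) ≤ 1) :
    eLpNorm (x - radialTrunc (l * v) x) p μ ≤ (l * v : ℝ≥0) := by
  have hp0 : p ≠ 0 := (zero_lt_one.trans_le hp).ne'
  rw [← ENNReal.rpow_le_rpow_iff (NNReal.coe_pos.2 (pos_iff_ne_zero.2 hp0)),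
    ← ENNReal.coe_rpow_of_nonneg _ p.coe_nonneg]
  calc eLpNorm (x - radialTrunc (l * v) x) p μ ^ (p : ℝ)
      ≤ ∫⁻ t, (((‖x t‖₊ ^ (p : ℝ) : ℝ≥0) : ℝ≥0∞) - ((l * v) ^ (p : ℝ) : ℝ≥0)) ∂μ :=
        eLpNorm_sub_radialTrunc_rpow_le hp _ x
    _ ≤ ∫⁻ t, ((l * v) ^ (p : ℝ) : ℝ≥0) * φ (l⁻¹ * ‖x t‖₊) ∂μ :=
        lintegral_mono fun t => rpow_tsub_mul_rpow_le hp0 h0 hc hv hl _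
    _ = ((l * v) ^ (p : ℝ) : ℝ≥0) * modular φ (l⁻¹ • x) := by
        rw [lintegral_const_mul' _ _ ENNReal.coe_ne_top, modular_nnreal_smul]
    _ ≤ ((l * v) ^ (p : ℝ) : ℝ≥0) := mul_le_of_le_one_right' hx

theorem sub_radialTrunc_mem_lebesgue (hp : 1 ≤ p) (h0 : φ 0 = 0)
    (hc : ConvexOn ℝ≥0 univ (fun u : ℝ≥0 => φ (u ^ (1 / (p : ℝ))))) (hv : 1 ≤ φ v) (hl : 0 < l)
    (hx : modular φ (l⁻¹ • x) ≤ 1) :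
    x - radialTrunc (l * v) x ∈ (FnSpace.lebesgue 𝕜 μ p).carrier :=
  Lp.mem_Lp_iff_eLpNorm_lt_top.2
    ((eLpNorm_sub_radialTrunc_le hp h0 hc hv hl hx).trans_lt ENNReal.coe_lt_top)

theorem orliczCarrier_subset_sum (hp : 1 ≤ p) (hφ : IsOrliczFunction φ)
    (hc : ConvexOn ℝ≥0 univ (fun u : ℝ≥0 => φ (u ^ (1 / (p : ℝ))))) :
    (orliczCarrier φ : Set (Ω →ₘ[μ] 𝕜)) ⊆
      FnSpace.sum (FnSpace.lebesgue 𝕜 μ p) (FnSpace.lebesgue 𝕜 μ ⊤) := by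
  intro x hx
  obtain ⟨v, -, hv⟩ := hφ.exists_le 1
  obtain ⟨l, hl, -⟩ := ENNReal.lt_iff_exists_nnreal_btwn.1
    ((mem_orliczCarrier_iff_luxemburgNorm_lt_top hφ x).1 hx)
  exact ⟨_, sub_radialTrunc_mem_lebesgue hp hφ.map_zero hc hv
    (ENNReal.coe_pos.1 (zero_le.trans_lt hl)) (modular_le_one_of_luxemburgNorm_lt hφ.mono hl),
    _, radialTrunc_mem_lebesgue_top (l * v) x, sub_add_cancel _ _⟩

theorem sumNrm_le_of_modular_le_one (hp : 1 ≤ p) (h0 : φ 0 = 0)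
    (hc : ConvexOn ℝ≥0 univ (fun u : ℝ≥0 => φ (u ^ (1 / (p : ℝ))))) (hv : 1 ≤ φ v) (hl : 0 < l)
    (hx : modular φ (l⁻¹ • x) ≤ 1) :
    FnSpace.sumNrm (FnSpace.lebesgue 𝕜 μ p) (FnSpace.lebesgue 𝕜 μ ⊤) x ≤ (2 * v : ℝ≥0) * l :=
  calc FnSpace.sumNrm (FnSpace.lebesgue 𝕜 μ p) (FnSpace.lebesgue 𝕜 μ ⊤) x
      ≤ eLpNorm (x - radialTrunc (l * v) x) p μ + eLpNorm (radialTrunc (l * v) x) ⊤ μ :=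
        iInf₂_le_of_le _ (sub_radialTrunc_mem_lebesgue hp h0 hc hv hl hx) <|
          iInf₂_le_of_le _ (radialTrunc_mem_lebesgue_top (l * v) x) <|
            iInf_le_of_le (sub_add_cancel _ _).symm le_rfl
    _ ≤ (l * v : ℝ≥0) + (l * v : ℝ≥0) :=
        add_le_add (eLpNorm_sub_radialTrunc_le hp h0 hc hv hl hx)
          (eLpNorm_top_radialTrunc_le (l * v) x)
    _ = (2 * v : ℝ≥0) * l := by push_cast; ring

theorem sumNrm_le_mul_luxemburgNorm (hp : 1 ≤ p) (hφ : IsOrliczFunction φ)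
    (hc : ConvexOn ℝ≥0 univ (fun u : ℝ≥0 => φ (u ^ (1 / (p : ℝ))))) (hv : 1 ≤ φ v)
    (x : Ω →ₘ[μ] 𝕜) :
    FnSpace.sumNrm (FnSpace.lebesgue 𝕜 μ p) (FnSpace.lebesgue 𝕜 μ ⊤) x ≤
      (2 * v : ℝ≥0) * luxemburgNorm φ x := by
  have hv0 : v ≠ 0 := by
    rintro rfl
    exact one_ne_zero (le_antisymm (hv.trans_eq hφ.map_zero) zero_le)
  rw [← ENNReal.div_le_iff' (ENNReal.coe_ne_zero.2 (mul_ne_zero two_ne_zero hv0))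
    ENNReal.coe_ne_top]
  refine le_of_forall_gt_imp_ge_of_dense fun a ha => ?_
  obtain ⟨l, hxl, hla⟩ := ENNReal.lt_iff_exists_nnreal_btwn.1 ha
  refine le_trans (ENNReal.div_le_of_le_mul' ?_) hla.le
  exact sumNrm_le_of_modular_le_one hp hφ.map_zero hc hv (ENNReal.coe_pos.1 (zero_le.trans_lt hxl))
    (modular_le_one_of_luxemburgNorm_lt hφ.mono hxl)

theorem FnSpace.IsAdmissible.maxNrm_lt_top {X₀ X₁ : FnSpace 𝕜 μ}
    {T : FnSpace.sum X₀ X₁ → FnSpace.sum X₀ X₁} (hT : FnSpace.IsAdmissible T) :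
    FnSpace.maxNrm T < ⊤ :=
  max_lt hT.bounded₀ hT.bounded₁

section Operator

variable {T : FnSpace.sum (FnSpace.lebesgue 𝕜 μ p) (FnSpace.lebesgue 𝕜 μ ⊤) →
    FnSpace.sum (FnSpace.lebesgue 𝕜 μ p) (FnSpace.lebesgue 𝕜 μ ⊤)}

theorem weightedNorm_apply_le_of_maxNrm_lt (hp : 1 ≤ p) (hm : Monotone φ) (h0 : φ 0 = 0)
    (hl : IsLeftContinuous φ) (hc : ConvexOn ℝ≥0 univ (fun u : ℝ≥0 => φ (u ^ (1 / (p : ℝ)))))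
    (hW : Monotone W) (hT : FnSpace.IsAdmissible T) {K : ℝ≥0} (hM : FnSpace.maxNrm T < K)
    (x : FnSpace.sum (FnSpace.lebesgue 𝕜 μ p) (FnSpace.lebesgue 𝕜 μ ⊤)) :
    weightedNorm φ W (T x).1 ≤
      (2 ^ (1 - 1 / (p : ℝ)) * K : ℝ≥0) * weightedNorm φ W x.1 := by
  have hK : 0 < K := ENNReal.coe_pos.1 (zero_le.trans_lt hM)
  exact weightedNorm_le_mul_weightedNorm hW (mul_pos (NNReal.rpow_pos two_pos) hK)
    fun c hc0 => modular_smul_inv_smul_apply_le hp hm h0 hl hc hT hK hM.le hc0 x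

theorem mapsInto_orliczSpace (hp : 1 ≤ p) (hφ : IsOrliczFunction φ) (hl : IsLeftContinuous φ)
    (hc : ConvexOn ℝ≥0 univ (fun u : ℝ≥0 => φ (u ^ (1 / (p : ℝ))))) (hW : IsNormWeight W)
    (hT : FnSpace.IsAdmissible T) : FnSpace.MapsInto T (orliczSpace 𝕜 μ φ W) := by
  intro x hx
  rw [mem_orliczSpace_iff hφ hW] at hx ⊢
  obtain ⟨K, hK, -⟩ := ENNReal.lt_iff_exists_nnreal_btwn.1 hT.maxNrm_lt_top
  exact (weightedNorm_apply_le_of_maxNrm_lt hp hφ.mono hφ.map_zero hl hc hW.mono hT hK x).trans_lt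
    (ENNReal.mul_lt_top ENNReal.coe_lt_top hx)

theorem opNrm_orliczSpace_le (hp : 1 ≤ p) (hm : Monotone φ) (h0 : φ 0 = 0)
    (hl : IsLeftContinuous φ) (hc : ConvexOn ℝ≥0 univ (fun u : ℝ≥0 => φ (u ^ (1 / (p : ℝ)))))
    (hW : Monotone W) (hT : FnSpace.IsAdmissible T) :
    FnSpace.opNrm T (orliczSpace 𝕜 μ φ W) ≤ 2 ^ (1 - 1 / (p : ℝ)) * FnSpace.maxNrm T := by
  have hcoe : ((2 ^ (1 - 1 / (p : ℝ)) : ℝ≥0) : ℝ≥0∞) = 2 ^ (1 - 1 / (p : ℝ)) := by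
    rw [ENNReal.coe_rpow_of_ne_zero two_ne_zero, ENNReal.coe_ofNat]
  refine iSup₂_le fun x _ => iSup_le fun _ => ?_
  rw [← hcoe, ← ENNReal.div_le_iff' (ENNReal.coe_ne_zero.2 (NNReal.rpow_pos two_pos).ne')
    ENNReal.coe_ne_top]
  refine le_of_forall_gt_imp_ge_of_dense fun a ha => ?_
  obtain ⟨K, hMK, hKa⟩ := ENNReal.lt_iff_exists_nnreal_btwn.1 ha
  refine le_trans (ENNReal.div_le_of_le_mul' (ENNReal.div_le_of_le_mul ?_)) hKa.le
  rw [← ENNReal.coe_mul]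
  exact weightedNorm_apply_le_of_maxNrm_lt hp hm h0 hl hc hW hT hMK x

end Operator

theorem IsOrliczFunction.exists_pos_le_one (hφ : IsOrliczFunction φ) : ∃ w, 0 < w ∧ φ w ≤ 1 :=
  ((eventually_mem_nhdsWithin (a := (0 : ℝ≥0))).and
    (hφ.tendsto_zero.eventually (ge_mem_nhds zero_lt_one))).exists

theorem isInterpolationSpace_orliczSpace (hp : 1 ≤ p) (hφ : IsOrliczFunction φ)
    (hl : IsLeftContinuous φ) (hc : ConvexOn ℝ≥0 univ (fun u : ℝ≥0 => φ (u ^ (1 / (p : ℝ)))))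
    (hW : IsNormWeight W) :
    FnSpace.IsInterpolationSpace (FnSpace.lebesgue 𝕜 μ p) (FnSpace.lebesgue 𝕜 μ ⊤)
      (orliczSpace 𝕜 μ φ W) (2 ^ (1 - 1 / (p : ℝ))) := by
  obtain ⟨w, hw, hφw⟩ := hφ.exists_pos_le_one
  obtain ⟨v, -, hv⟩ := hφ.exists_le 1
  have hinter := luxemburgNorm_le_mul_interNrm (𝕜 := 𝕜) (μ := μ)
    (zero_lt_one.trans_le hp).ne' hφ.map_zero hc hw hφw
  refine ⟨hφ.isBanach_orliczSpace hl hW, fun x hx => ?_, ⟨(W 1).toNNReal * w⁻¹, fun x _ => ?_⟩,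
    orliczCarrier_subset_sum hp hφ hc, ⟨2 * v, fun x _ => ?_⟩,
    fun T hT => mapsInto_orliczSpace hp hφ hl hc hW hT,
    fun T hT => opNrm_orliczSpace_le hp hφ.mono hφ.map_zero hl hc hW.mono hT⟩
  · exact (mem_orliczCarrier_iff_luxemburgNorm_lt_top hφ x).2 <| (hinter x).trans_lt <|
      ENNReal.mul_lt_top ENNReal.coe_lt_top <|
        max_lt (Lp.mem_Lp_iff_eLpNorm_lt_top.1 hx.1) (Lp.mem_Lp_iff_eLpNorm_lt_top.1 hx.2)
  · rw [ENNReal.coe_mul, ENNReal.coe_toNNReal hW.map_one_ne_top, mul_assoc]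
    exact (weightedNorm_le_mul_luxemburgNorm hW x).trans (mul_le_mul_right (hinter x) _)
  · exact (sumNrm_le_mul_luxemburgNorm hp hφ hc hv x).trans
      (mul_le_mul_right (luxemburgNorm_le_weightedNorm hφ hW x) _)

end Interpolation

/-! ### The two parts of the theorem -/

section Main

variable {Ω : Type*} [MeasurableSpace Ω] {𝕜 : Type*} [RCLike 𝕜] {μ : Measure Ω}
  {φ : ℝ≥0 → ℝ≥0∞} {p : ℝ≥0}

theorem modular_inv_maxNrm_smul_apply_le (hp : 1 ≤ p) (hm : Monotone φ) (h0 : φ 0 = 0)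
    (hl : IsLeftContinuous φ) (hc : ConvexOn ℝ≥0 univ (fun u : ℝ≥0 => φ (u ^ (1 / (p : ℝ)))))
    {T : FnSpace.sum (FnSpace.lebesgue 𝕜 μ p) (FnSpace.lebesgue 𝕜 μ ⊤) →
      FnSpace.sum (FnSpace.lebesgue 𝕜 μ p) (FnSpace.lebesgue 𝕜 μ ⊤)} (hT : FnSpace.IsAdmissible T)
    (x : FnSpace.sum (FnSpace.lebesgue 𝕜 μ p) (FnSpace.lebesgue 𝕜 μ ⊤)) :
    modular φ (((2 : ℝ) ^ (1 - 1 / (p : ℝ)) * (FnSpace.maxNrm T).toReal)⁻¹ • (T x).1) ≤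
      modular φ x.1 := by
  have hsmul : ((2 : ℝ) ^ (1 - 1 / (p : ℝ)) * (FnSpace.maxNrm T).toReal)⁻¹ • (T x).1 =
      (2 ^ (1 - 1 / (p : ℝ)) * (FnSpace.maxNrm T).toNNReal)⁻¹ • (T x).1 := rfl
  rw [hsmul]
  rcases eq_zero_or_pos (FnSpace.maxNrm T).toNNReal with hM | hM
  · rw [hM, mul_zero, inv_zero, modular_nnreal_smul]
    simp only [zero_mul, h0, lintegral_zero, zero_le]
  · exact modular_inv_smul_apply_le hp hm h0 hl hc hT hM
      (ENNReal.coe_toNNReal hT.maxNrm_lt_top.ne).ge x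

theorem isInterpolationSpace_of_map_rhoStar {ρ : ℝ≥0 → ℝ≥0} {W : ℝ≥0∞ → ℝ≥0∞} (hp : 1 ≤ p)
    (hρ : ConcaveOn ℝ≥0 univ ρ) (hsurj : Function.Surjective (rhoStar ρ))
    (h : ∀ w, φ (rhoStar ρ w) = ((w ^ (p : ℝ) : ℝ≥0) : ℝ≥0∞)) (hW : IsNormWeight W) :
    FnSpace.IsInterpolationSpace (FnSpace.lebesgue 𝕜 μ p) (FnSpace.lebesgue 𝕜 μ ⊤)
      (orliczSpace 𝕜 μ φ W) (2 ^ (1 - 1 / (p : ℝ))) := by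
  have hs := strictMono_rhoStar hρ (NNReal.coe_ne_zero.2 (zero_lt_one.trans_le hp).ne') h
  have hφ := isOrliczFunction_of_map_rhoStar hρ hp hs hsurj h
  exact isInterpolationSpace_orliczSpace hp hφ
    (fun u => (continuous_of_map_rhoStar p.coe_nonneg hs hsurj h).continuousWithinAt)
    (convexOn_rpow_of_map_rhoStar hρ hp hφ.mono hsurj h) hW

end Main

theorem mainTheorem1_general {Ω : Type*} [MeasurableSpace Ω] (μ : Measure Ω)
    (𝕜 : Type*) [RCLike 𝕜] (p : ℝ≥0) (hp : 1 ≤ p) (φ : ℝ≥0 → ℝ≥0∞) :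
    (IsOrliczFunction φ → IsLeftContinuous φ →
      ConvexOn ℝ≥0 univ (fun u : ℝ≥0 => φ (u ^ (1 / (p : ℝ)))) →
      ∀ T : FnSpace.sum (FnSpace.lebesgue 𝕜 μ p) (FnSpace.lebesgue 𝕜 μ ⊤) →
          FnSpace.sum (FnSpace.lebesgue 𝕜 μ p) (FnSpace.lebesgue 𝕜 μ ⊤),
        FnSpace.IsAdmissible T →
        ∀ x, modular φ
            (((2 : ℝ) ^ (1 - 1 / (p : ℝ)) * (FnSpace.maxNrm T).toReal)⁻¹ • (T x).1) ≤
          modular φ x.1) ∧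
    (∀ ρ : ℝ≥0 → ℝ≥0, ConcaveOn ℝ≥0 univ ρ → rhoStar ρ '' Ioi 0 = Ioi 0 →
      φ 0 = 0 →
      (∀ u : ℝ≥0, 0 < u → φ (u ^ (1 / (p : ℝ)) * ρ (u ^ (-(1 / (p : ℝ))))) = u) →
      IsOrliczFunction φ ∧
      FnSpace.IsInterpolationSpace (FnSpace.lebesgue 𝕜 μ p) (FnSpace.lebesgue 𝕜 μ ⊤)
        (FnSpace.orliczLuxemburg 𝕜 μ φ) (2 ^ (1 - 1 / (p : ℝ))) ∧
      FnSpace.IsInterpolationSpace (FnSpace.lebesgue 𝕜 μ p) (FnSpace.lebesgue 𝕜 μ ⊤)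
        (FnSpace.orliczAmemiya 𝕜 μ φ) (2 ^ (1 - 1 / (p : ℝ))) ∧
      (p = 1 →
        FnSpace.IsInterpolationSpace (FnSpace.lebesgue 𝕜 μ 1) (FnSpace.lebesgue 𝕜 μ ⊤)
          (FnSpace.orliczLuxemburg 𝕜 μ φ) 1 ∧
        FnSpace.IsInterpolationSpace (FnSpace.lebesgue 𝕜 μ 1) (FnSpace.lebesgue 𝕜 μ ⊤)
          (FnSpace.orliczAmemiya 𝕜 μ φ) 1)) := by
  refine ⟨fun hφ hl hc T hT => modular_inv_maxNrm_smul_apply_le hp hφ.mono hφ.map_zero hl hc hT,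
    fun ρ hρ hrange h0 h => ?_⟩
  have hp0 : (p : ℝ) ≠ 0 := NNReal.coe_ne_zero.2 (zero_lt_one.trans_le hp).ne'
  have hmap := map_rhoStar_eq_rpow hp0 h0 h
  have hsurj := surjective_rhoStar hrange
  have hφ := isOrliczFunction_of_map_rhoStar hρ hp (strictMono_rhoStar hρ hp0 hmap) hsurj hmap
  have hluxemburg := isInterpolationSpace_of_map_rhoStar (𝕜 := 𝕜) (μ := μ) hp hρ hsurj hmap
    isNormWeight_luxemburgWeight
  have hamemiya := isInterpolationSpace_of_map_rhoStar (𝕜 := 𝕜) (μ := μ) hp hρ hsurj hmap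
    isNormWeight_one_add
  rw [← orliczLuxemburg_eq_orliczSpace] at hluxemburg
  rw [← orliczAmemiya_eq_orliczSpace] at hamemiya
  refine ⟨hφ, hluxemburg, hamemiya, ?_⟩
  rintro rfl
  have hone : (2 : ℝ≥0∞) ^ (1 - 1 / ((1 : ℝ≥0) : ℝ)) = 1 := by simp
  rw [hone, ENNReal.coe_one] at hluxemburg hamemiya
  exact ⟨hluxemburg, hamemiya⟩

theorem mainTheorem1 {Ω : Type*} [MeasurableSpace Ω] (μ : Measure Ω) [SigmaFinite μ]
    (𝕜 : Type*) [RCLike 𝕜] (p : ℝ≥0) (hp : 1 ≤ p) (φ : ℝ≥0 → ℝ≥0∞) :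
    -- (a) the modular estimate
    (IsOrliczFunction φ → IsLeftContinuous φ →
      ConvexOn ℝ≥0 univ (fun u : ℝ≥0 => φ (u ^ (1 / (p : ℝ)))) →
      ∀ T : FnSpace.sum (FnSpace.lebesgue 𝕜 μ p) (FnSpace.lebesgue 𝕜 μ ⊤) →
          FnSpace.sum (FnSpace.lebesgue 𝕜 μ p) (FnSpace.lebesgue 𝕜 μ ⊤),
        FnSpace.IsAdmissible T →
        ∀ x, modular φ
            (((2 : ℝ) ^ (1 - 1 / (p : ℝ)) * (FnSpace.maxNrm T).toReal)⁻¹ • (T x).1) ≤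
          modular φ x.1) ∧
    -- (b) interpolation with constant `2 ^ (1 - 1 / p)`, which is `1` for `p = 1`
    (∀ ρ : ℝ≥0 → ℝ≥0, IsConcaveQuasiConcave ρ → rhoStar ρ '' Ioi 0 = Ioi 0 →
      φ 0 = 0 →
      (∀ u : ℝ≥0, 0 < u → φ (u ^ (1 / (p : ℝ)) * ρ (u ^ (-(1 / (p : ℝ))))) = u) →
      IsOrliczFunction φ ∧
      FnSpace.IsInterpolationSpace (FnSpace.lebesgue 𝕜 μ p) (FnSpace.lebesgue 𝕜 μ ⊤)
        (FnSpace.orliczLuxemburg 𝕜 μ φ) (2 ^ (1 - 1 / (p : ℝ))) ∧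
      FnSpace.IsInterpolationSpace (FnSpace.lebesgue 𝕜 μ p) (FnSpace.lebesgue 𝕜 μ ⊤)
        (FnSpace.orliczAmemiya 𝕜 μ φ) (2 ^ (1 - 1 / (p : ℝ))) ∧
      (p = 1 →
        FnSpace.IsInterpolationSpace (FnSpace.lebesgue 𝕜 μ 1) (FnSpace.lebesgue 𝕜 μ ⊤)
          (FnSpace.orliczLuxemburg 𝕜 μ φ) 1 ∧
        FnSpace.IsInterpolationSpace (FnSpace.lebesgue 𝕜 μ 1) (FnSpace.lebesgue 𝕜 μ ⊤)
          (FnSpace.orliczAmemiya 𝕜 μ φ) 1)) := by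
  obtain ⟨hmodular, hinterpolation⟩ := mainTheorem1_general μ 𝕜 p hp φ
  exact ⟨hmodular, fun ρ hρ => hinterpolation ρ hρ.2⟩
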